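/- Let $1/2<s\le 1$, $T>0$, $\mu>s$, and let $f(u)=|u|^2u$. Functions are $2\pi$-periodic in $x$, $\widehat v(m)=\frac1{2\pi}\int_{-\pi}^{\pi}v(x)e^{-imx}\,dx$, $\|v\|=\big(\int_{-\pi}^{\pi}|v|^2dx\big)^{1/2}$, and $\|v\|_r=\big(\sum_{m\in\mathbb Z}(1+m^2)^r|\widehat v(m)|^2\big)^{1/2}$ is the norm of the periodic Sobolev space $H^r$. Let $u$ be a solution of $$iu_t-(-\partial_{xx})^su+f(u)=0\quad(0\le t\le T),\qquad u(0)=u_0,$$ where $(-\partial_{xx})^s$ has the Fourier symbol $|m|^{2s}$ (the equation is understood for each Fourier coefficient), such that $u(t)\in H^\mu$ for all $t\in[0,T]$ and $\sup_{0\le t\le T}\|u(t)\|_\mu<\infty$. For an integer $N\ge1$ let $S_N=\mathrm{span}\{e^{imx}:|m|\le N\}$, let $P_N$ be the $L^2$-orthogonal projection onto $S_N$, and let $F(v)=-i(-\partial_{xx})^sv+iP_Nf(v)$ for $v\in S_N$. Let $u^N:[0,T]\to S_N$ be the solution of $\frac{d}{dt}u^N=F(u^N)$, $u^N(0)=P_Nu_0$.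 Let $q\ge1$, let $b_1,\dots,b_q$ be nonzero real numbers, let $k>0$ and let $M$ be an integer with $Mk=T$; put $t_n=nk$. For $v\in S_N$, a system of stages started at $v$ is a family $Y^0,\dots,Y^q\in S_N$ with $$Y^0=v,\qquad Y^j=Y^{j-1}+kb_jF\Big(\frac{Y^j+Y^{j-1}}2\Big)\quad(1\le j\le q).$$ The fully discrete scheme asks for $U^0,\dots,U^M$ and $Y^{n,j}$ ($0\le n\le M-1$, $0\le j\le q$) in $S_N$ such that $U^0=P_Nu_0$ and, for $0\le n\le M-1$, $(Y^{n,j})_{0\le j\le q}$ is a system of stages started at $U^n$ and $U^{n+1}=Y^{n,q}$. The local temporal error is $\Theta^n=u^N(t_{n+1})-Z^{n,q}$, where $(Z^{n,j})_{0\le j\le q}$ is the system of stages started at $u^N(t_n)$. Let $\alpha>1$ be an integer and $C_\Theta$ a real number. Then there is a constant $C$, independent of $N$, $M$ and $k$, such that the following holds for all $N$, $M$, $k$ as above for which $$3\|P_Nu_0\|^2\,kN\max_{1\le j\le q}|b_j|<1\qquad\text{and}\qquad \max_{0\le n\le M-1}\|\Theta^n\|_s\le C_\Theta k^{\alpha+1}:$$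 the fully discrete scheme has a unique solution, and $$\max_{0\le n\le M}\|U^n-u(t_n)\|_s\le C\,(k^\alpha+N^{s-\mu}).$$ -/

import Mathlib

noncomputable section

namespace FNLS

/-- The period `2π` is positive; needed for the Fourier analysis on the circle. -/
instance fact_two_pi_pos : Fact (0 < 2 * Real.pi) := ⟨Real.two_pi_pos⟩

/-- The circle `ℝ / 2πℤ`; functions on it are the `2π`-periodic functions. -/
abbrev Circ : Type := AddCircle (2 * Real.pi)

/-- The nonlinearity `f(u) = |u|² u`. -/
def cubic (v : C(Circ, ℂ)) : C(Circ, ℂ) where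
  toFun x := ((‖v x‖ ^ 2 : ℝ) : ℂ) * v x
  continuous_toFun := by fun_prop

/-- The norm `‖v‖ = (∫_{-π}^{π} |v|² dx)^{1/2}` of `L²(-π, π)`. -/
def l2Norm (v : C(Circ, ℂ)) : ℝ :=
  Real.sqrt (∫ x in (-Real.pi)..Real.pi, ‖v (x : Circ)‖ ^ 2)

/-- Membership in the periodic Sobolev space `H^r`.  Only orders `r > 1/2` occur, so that every
element of `H^r` is (represented by) a continuous function.  Here `fourierCoeff v m` is
`(1 / 2π) ∫_{-π}^{π} v(x) e^{-imx} dx`. -/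
def MemH (r : ℝ) (v : C(Circ, ℂ)) : Prop :=
  Summable fun m : ℤ => (1 + (m : ℝ) ^ 2) ^ r * ‖fourierCoeff v m‖ ^ 2

/-- The norm `‖v‖_r = (∑_{m ∈ ℤ} (1 + m²)^r |v̂(m)|²)^{1/2}` of `H^r`. -/
def hNorm (r : ℝ) (v : C(Circ, ℂ)) : ℝ :=
  Real.sqrt (∑' m : ℤ, (1 + (m : ℝ) ^ 2) ^ r * ‖fourierCoeff v m‖ ^ 2)

/-- The space `S_N` of trigonometric polynomials of degree at most `N`. -/
def trigPoly (N : ℕ) : Submodule ℂ C(Circ, ℂ) :=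
  Submodule.span ℂ {e | ∃ m : ℤ, |m| ≤ (N : ℤ) ∧ e = fourier m}

/-- The projection `P_N v = ∑_{|m| ≤ N} v̂(m) e^{imx}` onto `S_N`. -/
def proj (N : ℕ) (v : C(Circ, ℂ)) : C(Circ, ℂ) :=
  ∑ m ∈ Finset.Icc (-(N : ℤ)) (N : ℤ), fourierCoeff v m • fourier m

/-- The fractional Laplacian `(-∂_xx)^s v = ∑_{|m| ≤ N} |m|^{2s} v̂(m) e^{imx}` of `v ∈ S_N`. -/
def fracLap (s : ℝ) (N : ℕ) (v : C(Circ, ℂ)) : C(Circ, ℂ) :=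
  ∑ m ∈ Finset.Icc (-(N : ℤ)) (N : ℤ),
    (((|(m : ℝ)| ^ (2 * s) : ℝ) : ℂ) * fourierCoeff v m) • fourier m

/-- The vector field `F(v) = -i (-∂_xx)^s v + i P_N f(v)` on `S_N`. -/
def field (s : ℝ) (N : ℕ) (v : C(Circ, ℂ)) : C(Circ, ℂ) :=
  -(Complex.I • fracLap s N v) + Complex.I • proj N (cubic v)

/-- `u` solves `i u_t - (-∂_xx)^s u + f(u) = 0` on `[0, T]` with `u(0) = u₀`, in the weak sense:
the equation holds for every Fourier coefficient, that is, tested with every `e^{imx}`. -/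
structure IsSolution (s T : ℝ) (u₀ : C(Circ, ℂ)) (u : ℝ → C(Circ, ℂ)) : Prop where
  initial : u 0 = u₀
  equation : ∀ t ∈ Set.Icc (0 : ℝ) T, ∀ m : ℤ,
    HasDerivWithinAt (fun τ => fourierCoeff (u τ) m)
      (-(Complex.I * (((|(m : ℝ)| ^ (2 * s) : ℝ) : ℂ) * fourierCoeff (u t) m))
        + Complex.I * fourierCoeff (cubic (u t)) m)
      (Set.Icc 0 T) t

/-- `uN : [0, T] → S_N` is the semidiscrete Fourier-Galerkin approximation:
`d/dt uN = F(uN)` and `uN(0) = P_N u₀`. -/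
structure IsSemidiscrete (s T : ℝ) (N : ℕ) (u₀ : C(Circ, ℂ)) (uN : ℝ → C(Circ, ℂ)) : Prop where
  mem : ∀ t ∈ Set.Icc (0 : ℝ) T, uN t ∈ trigPoly N
  initial : uN 0 = proj N u₀
  equation : ∀ t ∈ Set.Icc (0 : ℝ) T,
    HasDerivWithinAt uN (field s N (uN t)) (Set.Icc 0 T) t

/-- The internal stages of one step of length `k` from `v`: `Y⁰ = v` and
`Y^j = Y^{j-1} + k b_j F((Y^j + Y^{j-1}) / 2)` in `S_N` for `j = 1, …, q`. The new value is `Y^q`.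
(`b_1, …, b_q` are indexed from `0` in the code.) -/
structure IsStages (s : ℝ) (N : ℕ) (k : ℝ) {q : ℕ} (b : Fin q → ℝ) (v : C(Circ, ℂ))
    (Y : Fin (q + 1) → C(Circ, ℂ)) : Prop where
  mem : ∀ j, Y j ∈ trigPoly N
  start : Y 0 = v
  step : ∀ j : Fin q, Y j.succ = Y j.castSucc
    + ((k * b j : ℝ) : ℂ) • field s N ((2 : ℂ)⁻¹ • (Y j.succ + Y j.castSucc))

/-- `(U^n)_{0 ≤ n ≤ M}` with the stages `(Y^{n,j})_{0 ≤ n < M, 0 ≤ j ≤ q}` is a solution of the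
fully discrete scheme with step size `k`. -/
structure IsFullyDiscrete (s : ℝ) (N M : ℕ) (k : ℝ) {q : ℕ} (b : Fin q → ℝ) (u₀ : C(Circ, ℂ))
    (U : Fin (M + 1) → C(Circ, ℂ)) (Y : Fin M → Fin (q + 1) → C(Circ, ℂ)) : Prop where
  initial : U 0 = proj N u₀
  stages : ∀ n : Fin M, IsStages s N k b (U n.castSucc) (Y n)
  update : ∀ n : Fin M, U n.succ = Y n (Fin.last q)

end FNLS

end

/-!
The error splits into a spatial part `uN - u` and a temporal part `U - uN`, both measured in `H^s`.
For `1/2 < s ≤ 1` the space `H^s` is an algebra (`exists_algebra_const`, by the Cauchy-Schwarz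
inequality in the convolution sum and the summability of `(1 + m²)^{-s}`), so the nonlinearity is
Lipschitz on bounded sets of `H^s` (`exists_cubic_const`). The dispersive part is skew-adjoint and
diagonal in Fourier space, so it never enters an estimate.

*Spatial error.* The energy of the Fourier modes `|m| ≤ N` of `uN - u` satisfies
`E' ≤ (1 + L²) E + L² δ²`, with `δ` of the order `N^{s-μ}` of the truncation error, as long as
`uN` stays near `u`. A barrier argument (`IsSemidiscrete.error_sq_le`) shows that it does so on all
of `[0, T]` once `N` is large; for the remaining `N` the conserved `L²` norm and an inverse
inequality suffice (`exists_semidiscrete_const`).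

*Solvability.* A stage is determined by the mean `W` of its end points, which is a fixed point of
the map with the dispersive part inverted. All stages conserve the `L²` norm
(`IsStep.hNorm_zero_eq`), and `‖W‖_∞² ≤ 3 N ‖W‖₀²` on `S_N`, so the smallness condition makes this
map a contraction in `L²` on a ball that contains every solution (`exists_mid`, `IsStep.unique`).

*Temporal error.* The fixed point iteration also preserves balls of `H^s` for short steps, so the
stages are bounded in `H^s` and a step amplifies differences by at most `exp(c k)`
(`exists_one_step_const`). Summing the local errors gives `O(k^α)`, which for small `k` is at most
one and thus confirms inductively that the discrete solution stays in the ball on which `c` is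
valid (`temporal_error_le`). If `k` is bounded from below, then the smallness condition bounds `N`
unless `u₀` vanishes, so the discrete solution is bounded and nothing has to be shown to be small
(`exists_large_step_bound`).

`hNorm 0` serves as the normalized `L²` norm: by Parseval, `l2Norm v ^ 2 = 2π * hNorm 0 v ^ 2`.
-/

noncomputable section

open scoped ENNReal ComplexConjugate
open MeasureTheory Filter Topology

namespace FNLS

/-! ### Fourier coefficients of continuous functions -/

/-- The `m`-th Fourier coefficient as a continuous linear functional on `C(Circ, ℂ)`. -/
def coefL (m : ℤ) : C(Circ, ℂ) →L[ℂ] ℂ :=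
  LinearMap.mkContinuous
    { toFun := fun v => fourierCoeff v m
      map_add' := fun v w => by
        have hi : ∀ v : C(Circ, ℂ), Integrable (v : Circ → ℂ) AddCircle.haarAddCircle :=
          fun v => v.continuous.integrable_of_hasCompactSupport
            (HasCompactSupport.of_compactSpace _)
        rw [ContinuousMap.coe_add, fourierCoeff.add (hi v) (hi w), Pi.add_apply]
      map_smul' := fun c v => by
        simp only [ContinuousMap.coe_smul, RingHom.id_apply]
        exact fourierCoeff.const_smul _ c m }
    1 (fun v => by
      have h := norm_integral_le_of_norm_le_const (μ := AddCircle.haarAddCircle (T := 2 * Real.pi))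
        (f := fun t : Circ => fourier (-m) t • v t) (C := ‖v‖)
        (Eventually.of_forall fun t => by
          rw [norm_smul, fourier_apply, Circle.norm_coe, one_mul]
          exact v.norm_coe_le_norm t)
      simpa [fourierCoeff] using h)

@[simp] lemma coefL_apply (m : ℤ) (v : C(Circ, ℂ)) : coefL m v = fourierCoeff v m := rfl

lemma coef_add (v w : C(Circ, ℂ)) (m : ℤ) :
    fourierCoeff (⇑(v + w)) m = fourierCoeff v m + fourierCoeff w m := map_add (coefL m) v w

lemma coef_sub (v w : C(Circ, ℂ)) (m : ℤ) :
    fourierCoeff (⇑(v - w)) m = fourierCoeff v m - fourierCoeff w m := map_sub (coefL m) v w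

lemma coef_neg (v : C(Circ, ℂ)) (m : ℤ) :
    fourierCoeff (⇑(-v)) m = -fourierCoeff v m := map_neg (coefL m) v

lemma coef_smul (c : ℂ) (v : C(Circ, ℂ)) (m : ℤ) :
    fourierCoeff (⇑(c • v)) m = c * fourierCoeff v m := map_smul (coefL m) c v

lemma coef_zero (m : ℤ) : fourierCoeff (⇑(0 : C(Circ, ℂ))) m = 0 := map_zero (coefL m)

lemma coef_fourier (n m : ℤ) :
    fourierCoeff (⇑(fourier n : C(Circ, ℂ))) m = if m = n then 1 else 0 := by
  rw [fourierCoeff_fourier]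
  simp [Pi.single_apply]

lemma coef_fourier_mul (n m : ℤ) (w : C(Circ, ℂ)) :
    fourierCoeff (⇑((fourier n : C(Circ, ℂ)) * w)) m = fourierCoeff w (m - n) := by
  unfold fourierCoeff
  congr 1
  ext t
  rw [show -(m - n) = -m + n by ring, fourier_add]
  simp only [ContinuousMap.mul_apply, smul_eq_mul]
  ring

lemma coef_star (v : C(Circ, ℂ)) (m : ℤ) :
    fourierCoeff (⇑(star v)) m = conj (fourierCoeff v (-m)) := by
  unfold fourierCoeff
  rw [← integral_conj]
  congr 1
  ext t
  simp only [ContinuousMap.star_apply, smul_eq_mul, map_mul, neg_neg, fourier_neg, RCLike.star_def]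

lemma parseval (v : C(Circ, ℂ)) :
    HasSum (fun m : ℤ => ‖fourierCoeff v m‖ ^ 2)
      (∫ t : Circ, ‖v t‖ ^ 2 ∂AddCircle.haarAddCircle) := by
  have h := hasSum_sq_fourierCoeff (ContinuousMap.toLp (E := ℂ) 2 AddCircle.haarAddCircle ℂ v)
  simp_rw [fourierCoeff_toLp] at h
  convert h using 1
  apply integral_congr_ae
  filter_upwards [ContinuousMap.coeFn_toLp (p := 2) (𝕜 := ℂ) AddCircle.haarAddCircle v] with t ht
  rw [ht]

/-! ### Sobolev norms -/

lemma wt_pos (r : ℝ) (m : ℤ) : 0 < (1 + (m : ℝ) ^ 2) ^ r :=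
  Real.rpow_pos_of_pos (by positivity) _

lemma hNorm_nonneg (r : ℝ) (v : C(Circ, ℂ)) : 0 ≤ hNorm r v := Real.sqrt_nonneg _

lemma hNorm_sq (r : ℝ) (v : C(Circ, ℂ)) :
    hNorm r v ^ 2 = ∑' m : ℤ, (1 + (m : ℝ) ^ 2) ^ r * ‖fourierCoeff v m‖ ^ 2 :=
  Real.sq_sqrt (tsum_nonneg fun m => mul_nonneg (wt_pos r m).le (sq_nonneg _))

lemma sum_le_hNorm_sq {r : ℝ} {v : C(Circ, ℂ)} (hv : MemH r v) (S : Finset ℤ) :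
    ∑ m ∈ S, (1 + (m : ℝ) ^ 2) ^ r * ‖fourierCoeff v m‖ ^ 2 ≤ hNorm r v ^ 2 := by
  rw [hNorm_sq]
  exact hv.sum_le_tsum S fun m _ => mul_nonneg (wt_pos r m).le (sq_nonneg _)

lemma memH_zero (v : C(Circ, ℂ)) : MemH 0 v := by
  simpa [MemH] using (parseval v).summable

lemma hNorm_zero_sq (v : C(Circ, ℂ)) :
    hNorm 0 v ^ 2 = ∫ t : Circ, ‖v t‖ ^ 2 ∂AddCircle.haarAddCircle := by
  rw [hNorm_sq]; simpa using (parseval v).tsum_eq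

/-- The unnormalized `L²` norm in terms of Fourier coefficients. -/
lemma l2Norm_sq (v : C(Circ, ℂ)) : l2Norm v ^ 2 = 2 * Real.pi * hNorm 0 v ^ 2 := by
  have h : ∫ x in (-Real.pi)..Real.pi, ‖v (x : Circ)‖ ^ 2
      = ∫ t : Circ, ‖v t‖ ^ 2 := by
    rw [← AddCircle.intervalIntegral_preimage (2 * Real.pi) (-Real.pi) (fun z => ‖v z‖ ^ 2)]
    congr 1; ring
  rw [l2Norm, Real.sq_sqrt, h, hNorm_zero_sq, AddCircle.integral_haarAddCircle, smul_eq_mul,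
    ← mul_assoc, mul_inv_cancel₀ Real.two_pi_pos.ne', one_mul]
  rw [h]
  exact integral_nonneg fun t => sq_nonneg _

/-- A pointwise bound of Fourier coefficients gives the corresponding bound of Sobolev norms;
this contains the triangle inequality and the monotonicity of the norm. -/
lemma hNorm_le_add {r c : ℝ} (hc : 0 ≤ c) {x v w : C(Circ, ℂ)} (hv : MemH r v) (hw : MemH r w)
    (h : ∀ m, ‖fourierCoeff x m‖ ≤ ‖fourierCoeff v m‖ + c * ‖fourierCoeff w m‖) :
    MemH r x ∧ hNorm r x ≤ hNorm r v + c * hNorm r w := by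
  set σ : ℤ → ℝ := fun m => Real.sqrt ((1 + (m : ℝ) ^ 2) ^ r)
  have hσ : ∀ m, σ m ^ 2 = (1 + (m : ℝ) ^ 2) ^ r := fun m => Real.sq_sqrt (wt_pos r m).le
  have hσ0 : ∀ m, 0 ≤ σ m := fun m => Real.sqrt_nonneg _
  have e1 : ∀ v : C(Circ, ℂ), (fun m : ℤ => (1 + (m : ℝ) ^ 2) ^ r * ‖fourierCoeff v m‖ ^ 2)
      = fun m => (σ m * ‖fourierCoeff v m‖) ^ (2 : ℝ) := by
    intro v; ext m; rw [Real.rpow_two, mul_pow, hσ]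
  have e2 : (fun m : ℤ => c ^ 2 * ((1 + (m : ℝ) ^ 2) ^ r * ‖fourierCoeff w m‖ ^ 2))
      = fun m : ℤ => (c * (σ m * ‖fourierCoeff w m‖)) ^ (2 : ℝ) := by
    ext m; rw [Real.rpow_two, mul_pow, mul_pow, hσ]
  have hv' := hv
  have hw' := hw.mul_left (c ^ 2)
  unfold MemH at hv'
  rw [e1] at hv'
  rw [e2] at hw'
  obtain ⟨hs, hle⟩ := Real.Lp_add_le_tsum_of_nonneg (p := 2) (by norm_num)
    (fun m => mul_nonneg (hσ0 m) (norm_nonneg (fourierCoeff v m)))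
    (fun m => mul_nonneg hc (mul_nonneg (hσ0 m) (norm_nonneg (fourierCoeff w m)))) hv' hw'
  have hb : ∀ m : ℤ, (1 + (m : ℝ) ^ 2) ^ r * ‖fourierCoeff x m‖ ^ 2
      ≤ (σ m * ‖fourierCoeff v m‖ + c * (σ m * ‖fourierCoeff w m‖)) ^ (2 : ℝ) := by
    intro m
    rw [Real.rpow_two, ← hσ, ← mul_pow]
    have := mul_le_mul_of_nonneg_left (h m) (hσ0 m)
    exact pow_le_pow_left₀ (mul_nonneg (hσ0 m) (norm_nonneg _)) (by linarith) 2
  have hx : MemH r x := Summable.of_nonneg_of_le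
    (fun m => mul_nonneg (wt_pos r m).le (sq_nonneg _)) hb hs
  refine ⟨hx, ?_⟩
  rw [← e1, ← e2, tsum_mul_left, ← Real.sqrt_eq_rpow, ← Real.sqrt_eq_rpow, ← Real.sqrt_eq_rpow,
    Real.sqrt_mul (sq_nonneg c), Real.sqrt_sq hc] at hle
  exact (Real.sqrt_le_sqrt (hx.tsum_le_tsum hb hs)).trans hle

lemma memH_of_zero (r : ℝ) : MemH r 0 := by
  simp only [MemH, coef_zero]; simp [summable_zero]

@[simp] lemma hNorm_of_zero (r : ℝ) : hNorm r 0 = 0 := by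
  simp only [hNorm, coef_zero]; simp

lemma hNorm_le_mul {r c : ℝ} (hc : 0 ≤ c) {x w : C(Circ, ℂ)} (hw : MemH r w)
    (h : ∀ m, ‖fourierCoeff x m‖ ≤ c * ‖fourierCoeff w m‖) :
    MemH r x ∧ hNorm r x ≤ c * hNorm r w := by
  have := hNorm_le_add hc (memH_of_zero r) hw (x := x)
    (by simpa only [coef_zero, norm_zero, zero_add] using h)
  simpa using this

lemma hNorm_mono {r : ℝ} {x w : C(Circ, ℂ)} (hw : MemH r w)
    (h : ∀ m, ‖fourierCoeff x m‖ ≤ ‖fourierCoeff w m‖) :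
    MemH r x ∧ hNorm r x ≤ hNorm r w := by
  simpa using hNorm_le_mul zero_le_one hw (x := x) (by simpa using h)

lemma MemH.add {r : ℝ} {v w : C(Circ, ℂ)} (hv : MemH r v) (hw : MemH r w) :
    MemH r (v + w) ∧ hNorm r (v + w) ≤ hNorm r v + hNorm r w := by
  simpa using hNorm_le_add zero_le_one hv hw (x := v + w)
    (fun m => by rw [coef_add, one_mul]; exact norm_add_le _ _)

lemma MemH.sub {r : ℝ} {v w : C(Circ, ℂ)} (hv : MemH r v) (hw : MemH r w) :
    MemH r (v - w) ∧ hNorm r (v - w) ≤ hNorm r v + hNorm r w := by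
  simpa using hNorm_le_add zero_le_one hv hw (x := v - w)
    (fun m => by rw [coef_sub, one_mul]; exact norm_sub_le _ _)

lemma hNorm_smul_le {r : ℝ} (c : ℂ) {v : C(Circ, ℂ)} (hv : MemH r v) :
    MemH r (c • v) ∧ hNorm r (c • v) ≤ ‖c‖ * hNorm r v :=
  hNorm_le_mul (norm_nonneg c) hv fun m => by rw [coef_smul, norm_mul]

lemma wt_mono {r r' : ℝ} (h : r ≤ r') (m : ℤ) :
    (1 + (m : ℝ) ^ 2) ^ r ≤ (1 + (m : ℝ) ^ 2) ^ r' :=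
  Real.rpow_le_rpow_of_exponent_le (by nlinarith [sq_nonneg (m : ℝ)]) h

lemma MemH.mono {r r' : ℝ} (h : r ≤ r') {v : C(Circ, ℂ)} (hv : MemH r' v) :
    MemH r v ∧ hNorm r v ≤ hNorm r' v := by
  have hb : ∀ m : ℤ, (1 + (m : ℝ) ^ 2) ^ r * ‖fourierCoeff v m‖ ^ 2
      ≤ (1 + (m : ℝ) ^ 2) ^ r' * ‖fourierCoeff v m‖ ^ 2 := fun m => by
    gcongr ?_ * _
    exact wt_mono h m
  have hx : MemH r v := Summable.of_nonneg_of_le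
    (fun m => mul_nonneg (wt_pos r m).le (sq_nonneg _)) hb hv
  exact ⟨hx, Real.sqrt_le_sqrt (hx.tsum_le_tsum hb hv)⟩

lemma MemH.star {r : ℝ} {v : C(Circ, ℂ)} (hv : MemH r v) :
    MemH r (star v) ∧ hNorm r (star v) = hNorm r v := by
  have e : (fun m : ℤ => (1 + (m : ℝ) ^ 2) ^ r * ‖fourierCoeff (⇑(Star.star v)) m‖ ^ 2)
      = (fun m : ℤ => (1 + (m : ℝ) ^ 2) ^ r * ‖fourierCoeff v m‖ ^ 2) ∘ Equiv.neg ℤ := by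
    ext m; simp only [coef_star, Function.comp_apply, Equiv.neg_apply, Int.cast_neg, neg_sq,
      RCLike.norm_conj]
  constructor
  · unfold MemH
    rw [e]
    exact (Equiv.neg ℤ).summable_iff.mpr hv
  · unfold hNorm
    rw [e]
    congr 1
    exact (Equiv.neg ℤ).tsum_eq
      (fun m : ℤ => (1 + (m : ℝ) ^ 2) ^ r * ‖fourierCoeff v m‖ ^ 2)

/-- A pointwise bound of functions gives a bound of their `L²` norms. -/
lemma hNorm_zero_le_of_pointwise {c : ℝ} (hc : 0 ≤ c) {g h : C(Circ, ℂ)}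
    (H : ∀ x, ‖g x‖ ≤ c * ‖h x‖) : hNorm 0 g ≤ c * hNorm 0 h := by
  have hi : ∀ v : C(Circ, ℂ), Integrable (fun t => ‖v t‖ ^ 2) AddCircle.haarAddCircle :=
    fun v => Continuous.integrable_of_hasCompactSupport (by fun_prop)
      (HasCompactSupport.of_compactSpace _)
  apply le_of_sq_le_sq _ (mul_nonneg hc (hNorm_nonneg _ _))
  rw [mul_pow, hNorm_zero_sq, hNorm_zero_sq, ← integral_const_mul]
  refine integral_mono (hi g) ((hi h).const_mul _) fun t => ?_
  simp only
  rw [← mul_pow]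
  exact pow_le_pow_left₀ (norm_nonneg _) (H t) 2

/-! ### The Sobolev algebra property -/

/-- The Cauchy-Schwarz inequality for sums of extended nonnegative reals. -/
lemma enn_tsum_mul_sq_le {ι : Type*} (f g : ι → ℝ≥0∞) :
    (∑' i, f i * g i) ^ 2 ≤ (∑' i, f i ^ 2) * ∑' i, g i ^ 2 := by
  let _ : MeasurableSpace ι := ⊤
  have h := ENNReal.lintegral_mul_le_Lp_mul_Lq (Measure.count : Measure ι)
    (Real.HolderConjugate.two_two) (f := f) (g := g) measurable_from_top.aemeasurable
    measurable_from_top.aemeasurable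
  simp only [Pi.mul_apply, lintegral_count, ENNReal.rpow_two] at h
  calc (∑' i, f i * g i) ^ 2
      ≤ ((∑' i, f i ^ 2) ^ (1 / 2 : ℝ) * (∑' i, g i ^ 2) ^ (1 / 2 : ℝ)) ^ 2 := by gcongr
    _ = _ := by
      rw [mul_pow, ← ENNReal.rpow_natCast, ← ENNReal.rpow_natCast, ← ENNReal.rpow_mul,
        ← ENNReal.rpow_mul]
      norm_num

/-- A weighted Young inequality: if the weight `σ²` is subadditive up to the factor `c`, then
the weighted `ℓ²` norm is submultiplicative for convolution, with a constant that is finite when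
`σ⁻¹` is square summable. -/
lemma weighted_convolution_le (σ a b : ℤ → ℝ≥0∞) (h0 : ∀ m, σ m ≠ 0) (ht : ∀ m, σ m ≠ ⊤)
    (c : ℝ≥0∞) (hsub : ∀ n m, σ n ^ 2 ≤ c * (σ m ^ 2 + σ (n - m) ^ 2)) :
    ∑' n, (σ n * ∑' m, a m * b (n - m)) ^ 2
      ≤ c * (2 * ∑' m, (σ m)⁻¹ ^ 2) * ((∑' m, (σ m * a m) ^ 2) * ∑' m, (σ m * b m) ^ 2) := by
  have hinv : ∀ m, (σ m)⁻¹ * σ m = 1 := fun m => ENNReal.inv_mul_cancel (h0 m) (ht m)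
  have shift : ∀ (g : ℤ → ℝ≥0∞) (n : ℤ), ∑' m, g (n - m) = ∑' m, g m := fun g n =>
    (Equiv.subLeft n).tsum_eq g
  have shift' : ∀ (g : ℤ → ℝ≥0∞) (m : ℤ), ∑' n, g (n - m) = ∑' n, g n := fun g m =>
    (Equiv.subRight m).tsum_eq g
  have key : ∀ n, (σ n * ∑' m, a m * b (n - m)) ^ 2
      ≤ c * (2 * ∑' m, (σ m)⁻¹ ^ 2) * ∑' m, (σ m * a m) ^ 2 * (σ (n - m) * b (n - m)) ^ 2 := by
    intro n
    have e : ∀ m, a m * b (n - m)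
        = ((σ m)⁻¹ * (σ (n - m))⁻¹) * ((σ m * a m) * (σ (n - m) * b (n - m))) := by
      intro m
      calc a m * b (n - m) = ((σ m)⁻¹ * σ m) * ((σ (n - m))⁻¹ * σ (n - m)) * (a m * b (n - m)) := by
            rw [hinv, hinv, one_mul, one_mul]
        _ = _ := by ring
    have w : ∀ m, σ n ^ 2 * ((σ m)⁻¹ * (σ (n - m))⁻¹) ^ 2
        ≤ c * ((σ (n - m))⁻¹ ^ 2 + (σ m)⁻¹ ^ 2) := by
      intro m
      calc σ n ^ 2 * ((σ m)⁻¹ * (σ (n - m))⁻¹) ^ 2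
          ≤ c * (σ m ^ 2 + σ (n - m) ^ 2) * ((σ m)⁻¹ * (σ (n - m))⁻¹) ^ 2 := by
            gcongr; exact hsub n m
        _ = c * (((σ m)⁻¹ * σ m) ^ 2 * (σ (n - m))⁻¹ ^ 2
              + ((σ (n - m))⁻¹ * σ (n - m)) ^ 2 * (σ m)⁻¹ ^ 2) := by ring
        _ = _ := by rw [hinv, hinv]; simp
    simp_rw [e]
    rw [mul_pow]
    calc σ n ^ 2 * (∑' m, ((σ m)⁻¹ * (σ (n - m))⁻¹) * ((σ m * a m) * (σ (n - m) * b (n - m)))) ^ 2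
        ≤ σ n ^ 2 * ((∑' m, ((σ m)⁻¹ * (σ (n - m))⁻¹) ^ 2)
            * ∑' m, ((σ m * a m) * (σ (n - m) * b (n - m))) ^ 2) := by
          gcongr; exact enn_tsum_mul_sq_le _ _
      _ = (∑' m, σ n ^ 2 * ((σ m)⁻¹ * (σ (n - m))⁻¹) ^ 2)
            * ∑' m, (σ m * a m) ^ 2 * (σ (n - m) * b (n - m)) ^ 2 := by
          rw [ENNReal.tsum_mul_left, mul_assoc]; simp_rw [mul_pow]
      _ ≤ (∑' m, c * ((σ (n - m))⁻¹ ^ 2 + (σ m)⁻¹ ^ 2))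
            * ∑' m, (σ m * a m) ^ 2 * (σ (n - m) * b (n - m)) ^ 2 := by
          exact mul_le_mul_left (ENNReal.tsum_le_tsum w) _
      _ = _ := by
          rw [ENNReal.tsum_mul_left, ENNReal.tsum_add, shift (fun m => (σ m)⁻¹ ^ 2) n, ← two_mul]
  calc ∑' n, (σ n * ∑' m, a m * b (n - m)) ^ 2
      ≤ ∑' n, c * (2 * ∑' m, (σ m)⁻¹ ^ 2)
          * ∑' m, (σ m * a m) ^ 2 * (σ (n - m) * b (n - m)) ^ 2 := ENNReal.tsum_le_tsum key
    _ = c * (2 * ∑' m, (σ m)⁻¹ ^ 2)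
          * ∑' m, ∑' n, (σ m * a m) ^ 2 * (σ (n - m) * b (n - m)) ^ 2 := by
        rw [ENNReal.tsum_mul_left, ENNReal.tsum_comm]
    _ = _ := by
        simp_rw [ENNReal.tsum_mul_left]
        simp_rw [shift' (fun k => (σ k * b k) ^ 2)]
        rw [ENNReal.tsum_mul_right]

/-- The square root `(1 + m²)^{r/2}` of the Sobolev weight. -/
def sobWt (r : ℝ) (m : ℤ) : ℝ≥0∞ := ENNReal.ofReal (Real.sqrt ((1 + (m : ℝ) ^ 2) ^ r))

lemma sobWt_ne_zero (r : ℝ) (m : ℤ) : sobWt r m ≠ 0 := by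
  have := wt_pos r m
  simp [sobWt, this]

lemma sobWt_ne_top (r : ℝ) (m : ℤ) : sobWt r m ≠ ⊤ := ENNReal.ofReal_ne_top

lemma sobWt_sq (r : ℝ) (m : ℤ) : sobWt r m ^ 2 = ENNReal.ofReal ((1 + (m : ℝ) ^ 2) ^ r) := by
  rw [sobWt, ← ENNReal.ofReal_pow (Real.sqrt_nonneg _), Real.sq_sqrt (wt_pos r m).le]

lemma sobWt_mul_sq (r : ℝ) (m : ℤ) (z : ℂ) :
    (sobWt r m * ‖z‖ₑ) ^ 2 = ENNReal.ofReal ((1 + (m : ℝ) ^ 2) ^ r * ‖z‖ ^ 2) := by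
  rw [mul_pow, sobWt_sq, ENNReal.ofReal_mul (wt_pos r m).le, ← ofReal_norm,
    ENNReal.ofReal_pow (norm_nonneg _)]

lemma memH_iff (r : ℝ) (v : C(Circ, ℂ)) :
    MemH r v ↔ ∑' m, (sobWt r m * ‖fourierCoeff v m‖ₑ) ^ 2 ≠ ⊤ := by
  simp_rw [sobWt_mul_sq]
  constructor
  · intro h; exact h.tsum_ofReal_ne_top
  · intro h
    have := ENNReal.summable_toReal h
    refine this.congr fun m => ENNReal.toReal_ofReal ?_
    exact mul_nonneg (wt_pos r m).le (sq_nonneg _)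

lemma ofReal_hNorm_sq {r : ℝ} {v : C(Circ, ℂ)} (hv : MemH r v) :
    ENNReal.ofReal (hNorm r v ^ 2) = ∑' m, (sobWt r m * ‖fourierCoeff v m‖ₑ) ^ 2 := by
  rw [hNorm_sq, ENNReal.ofReal_tsum_of_nonneg
    (fun m => mul_nonneg (wt_pos r m).le (sq_nonneg _)) hv]
  simp_rw [sobWt_mul_sq]

lemma sobWt_sq_subadditive {s : ℝ} (hs : 0 ≤ s) (hs1 : s ≤ 1) (n m : ℤ) :
    sobWt s n ^ 2 ≤ 2 * (sobWt s m ^ 2 + sobWt s (n - m) ^ 2) := by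
  rw [sobWt_sq, sobWt_sq, sobWt_sq, ← ENNReal.ofReal_add (wt_pos _ _).le (wt_pos _ _).le,
    show (2 : ℝ≥0∞) = ENNReal.ofReal 2 by simp, ← ENNReal.ofReal_mul (by norm_num)]
  apply ENNReal.ofReal_le_ofReal
  push_cast
  set x : ℝ := (m : ℝ)
  set y : ℝ := (n : ℝ) - x
  have hn : (n : ℝ) = x + y := by simp [y]
  rw [hn]
  calc (1 + (x + y) ^ 2) ^ s ≤ (2 * ((1 + x ^ 2) + (1 + y ^ 2))) ^ s := by
        apply Real.rpow_le_rpow (by positivity) _ hs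
        nlinarith [sq_nonneg (x - y)]
    _ = 2 ^ s * ((1 + x ^ 2) + (1 + y ^ 2)) ^ s := Real.mul_rpow (by norm_num) (by positivity)
    _ ≤ 2 * ((1 + x ^ 2) ^ s + (1 + y ^ 2) ^ s) := by
        gcongr
        · calc (2 : ℝ) ^ s ≤ 2 ^ (1 : ℝ) := Real.rpow_le_rpow_of_exponent_le (by norm_num) hs1
            _ = 2 := by norm_num
        · exact Real.rpow_add_le_add_rpow (by positivity) (by positivity) hs hs1

lemma tsum_inv_sobWt_sq_ne_top {s : ℝ} (hs : 1 / 2 < s) : ∑' m, (sobWt s m)⁻¹ ^ 2 ≠ ⊤ := by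
  have e : ∀ m, (sobWt s m)⁻¹ ^ 2 = ENNReal.ofReal (((1 + (m : ℝ) ^ 2) ^ s)⁻¹) := by
    intro m
    rw [← ENNReal.inv_pow, sobWt_sq, ENNReal.ofReal_inv_of_pos (wt_pos s m)]
  simp_rw [e]
  apply Summable.tsum_ofReal_ne_top
  have h := Real.summable_abs_int_rpow (b := 2 * s) (by linarith)
  refine Summable.of_norm_bounded_eventually h ?_
  have : ∀ᶠ m : ℤ in cofinite, m ≠ 0 :=
    (Set.finite_singleton (0 : ℤ)).compl_mem_cofinite
  filter_upwards [this] with m hm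
  have hm' : 0 < |(m : ℝ)| := abs_pos.mpr (by exact_mod_cast hm)
  rw [Real.norm_of_nonneg (inv_nonneg.mpr (wt_pos s m).le), Real.rpow_neg hm'.le,
    Real.rpow_mul hm'.le]
  have : 0 < (|(m : ℝ)| ^ (2 : ℝ)) ^ s := by positivity
  apply inv_anti₀ this
  apply Real.rpow_le_rpow (by positivity) _ (by linarith)
  rw [Real.rpow_two, sq_abs]; linarith

lemma MemH.summable_coef {s : ℝ} (hs : 1 / 2 < s) {v : C(Circ, ℂ)} (hv : MemH s v) :
    Summable (fourierCoeff v) := by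
  apply Summable.of_norm
  have h := enn_tsum_mul_sq_le (fun m => (sobWt s m)⁻¹)
    (fun m => sobWt s m * ‖fourierCoeff v m‖ₑ)
  have e : ∀ m, (sobWt s m)⁻¹ * (sobWt s m * ‖fourierCoeff v m‖ₑ) = ‖fourierCoeff v m‖ₑ := by
    intro m
    rw [← mul_assoc, ENNReal.inv_mul_cancel (sobWt_ne_zero s m) (sobWt_ne_top s m), one_mul]
  simp_rw [e] at h
  have ht : ∑' m, ‖fourierCoeff v m‖ₑ ≠ ⊤ := by
    intro h'
    rw [h'] at h
    exact ENNReal.mul_ne_top (tsum_inv_sobWt_sq_ne_top hs) ((memH_iff s v).mp hv)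
      (top_le_iff.mp (by simpa using h))
  simpa using ENNReal.summable_toReal ht

lemma coef_mul_hasSum {v w : C(Circ, ℂ)} (hv : Summable (fourierCoeff v)) (n : ℤ) :
    HasSum (fun m => fourierCoeff v m * fourierCoeff w (n - m)) (fourierCoeff (⇑(v * w)) n) := by
  have h1 := (hasSum_fourier_series_of_summable hv).mul_right w
  have h2 := (coefL n).hasSum h1
  refine h2.congr_fun fun m => ?_
  rw [smul_mul_assoc, coefL_apply, coef_smul, coef_fourier_mul]

/-- `H^s` is a Banach algebra for `1/2 < s ≤ 1`. -/
lemma exists_algebra_const {s : ℝ} (hs : 1 / 2 < s) (hs1 : s ≤ 1) :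
    ∃ K : ℝ, 0 < K ∧ ∀ v w : C(Circ, ℂ), MemH s v → MemH s w →
      MemH s (v * w) ∧ hNorm s (v * w) ≤ K * (hNorm s v * hNorm s w) := by
  set A : ℝ≥0∞ := 2 * (2 * ∑' m, (sobWt s m)⁻¹ ^ 2)
  have hA : A ≠ ⊤ := ENNReal.mul_ne_top (by simp)
    (ENNReal.mul_ne_top (by simp) (tsum_inv_sobWt_sq_ne_top hs))
  refine ⟨Real.sqrt A.toReal + 1, by positivity, fun v w hv hw => ?_⟩
  have hle : ∑' n, (sobWt s n * ‖fourierCoeff (⇑(v * w)) n‖ₑ) ^ 2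
      ≤ ENNReal.ofReal (A.toReal * (hNorm s v ^ 2 * hNorm s w ^ 2)) := by
    rw [ENNReal.ofReal_mul ENNReal.toReal_nonneg, ENNReal.ofReal_mul (sq_nonneg _),
      ENNReal.ofReal_toReal hA, ofReal_hNorm_sq hv, ofReal_hNorm_sq hw]
    refine le_trans (ENNReal.tsum_le_tsum fun n => ?_) (weighted_convolution_le (sobWt s)
      (fun m => ‖fourierCoeff v m‖ₑ) (fun m => ‖fourierCoeff w m‖ₑ) (sobWt_ne_zero s)
      (sobWt_ne_top s) 2 (sobWt_sq_subadditive (by linarith) hs1))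
    gcongr
    rw [← (coef_mul_hasSum (hv.summable_coef hs) n).tsum_eq]
    refine enorm_tsum_le_tsum_enorm.trans (le_of_eq ?_)
    simp_rw [enorm_mul]
  have hm : MemH s (v * w) := (memH_iff _ _).mpr (ne_top_of_le_ne_top ENNReal.ofReal_ne_top hle)
  refine ⟨hm, ?_⟩
  rw [← ofReal_hNorm_sq hm, ENNReal.ofReal_le_ofReal_iff
    (mul_nonneg ENNReal.toReal_nonneg (by positivity))] at hle
  have h0 := mul_nonneg (hNorm_nonneg s v) (hNorm_nonneg s w)
  calc hNorm s (v * w) ≤ Real.sqrt A.toReal * (hNorm s v * hNorm s w) := by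
        apply le_of_sq_le_sq _ (by positivity)
        rw [mul_pow, Real.sq_sqrt ENNReal.toReal_nonneg]
        linarith [hle]
    _ ≤ _ := by gcongr; linarith

lemma cubic_eq (v : C(Circ, ℂ)) : cubic v = v * v * star v := by
  ext x
  simp only [cubic, ContinuousMap.coe_mk, ContinuousMap.mul_apply, ContinuousMap.star_apply,
    RCLike.star_def]
  rw [mul_assoc, Complex.mul_conj, Complex.normSq_eq_norm_sq]
  ring

lemma cubic_sub (v w : C(Circ, ℂ)) : cubic v - cubic w
    = (v - w) * (v * star v) + (w * (v - w) * star v + w * w * star (v - w)) := by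
  rw [cubic_eq, cubic_eq, star_sub]; ring

/-- The cubic nonlinearity is bounded and locally Lipschitz in `H^s`. -/
lemma exists_cubic_const {s : ℝ} (hs : 1 / 2 < s) (hs1 : s ≤ 1) :
    ∃ K : ℝ, 0 < K ∧
      (∀ v : C(Circ, ℂ), MemH s v → MemH s (cubic v) ∧ hNorm s (cubic v) ≤ K * hNorm s v ^ 3) ∧
      ∀ (ρ : ℝ) (v w : C(Circ, ℂ)), MemH s v → MemH s w → hNorm s v ≤ ρ → hNorm s w ≤ ρ →
        MemH s (cubic v - cubic w) ∧
          hNorm s (cubic v - cubic w) ≤ K * ρ ^ 2 * hNorm s (v - w) := by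
  obtain ⟨K, hK, hmul⟩ := exists_algebra_const hs hs1
  -- the product of three factors
  have h3 : ∀ x y z : C(Circ, ℂ), MemH s x → MemH s y → MemH s z →
      MemH s (x * y * z) ∧ hNorm s (x * y * z) ≤ K ^ 2 * (hNorm s x * hNorm s y * hNorm s z) := by
    intro x y z hx hy hz
    obtain ⟨h1, h2⟩ := hmul x y hx hy
    obtain ⟨h4, h5⟩ := hmul _ z h1 hz
    refine ⟨h4, h5.trans ?_⟩
    have := hNorm_nonneg s z
    calc K * (hNorm s (x * y) * hNorm s z) ≤ K * (K * (hNorm s x * hNorm s y) * hNorm s z) := by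
          gcongr
      _ = _ := by ring
  refine ⟨3 * K ^ 2, by positivity, fun v hv => ?_, fun ρ v w hv hw hvρ hwρ => ?_⟩
  · obtain ⟨h1, h2⟩ := h3 v v (star v) hv hv hv.star.1
    rw [cubic_eq]
    refine ⟨h1, h2.trans ?_⟩
    rw [hv.star.2]
    have := pow_nonneg (hNorm_nonneg s v) 3
    nlinarith [mul_nonneg (sq_nonneg K) this]
  · have hd := (hv.sub hw).1
    have n1 := hNorm_nonneg s v
    have n2 := hNorm_nonneg s w
    have n3 := hNorm_nonneg s (v - w)
    obtain ⟨a1, a2⟩ := h3 (v - w) v (star v) hd hv hv.star.1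
    obtain ⟨b1, b2⟩ := h3 w (v - w) (star v) hw hd hv.star.1
    obtain ⟨c1, c2⟩ := h3 w w (star (v - w)) hw hw hd.star.1
    rw [hv.star.2] at a2 b2
    rw [hd.star.2] at c2
    rw [cubic_sub, ← mul_assoc]
    obtain ⟨d1, d2⟩ := b1.add c1
    obtain ⟨e1, e2⟩ := a1.add d1
    refine ⟨e1, ?_⟩
    have q1 : hNorm s (v - w) * hNorm s v * hNorm s v ≤ ρ ^ 2 * hNorm s (v - w) := by
      calc _ = (hNorm s v * hNorm s v) * hNorm s (v - w) := by ring
        _ ≤ (ρ * ρ) * hNorm s (v - w) := by gcongr; exact n1.trans hvρ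
        _ = _ := by ring
    have q2 : hNorm s w * hNorm s (v - w) * hNorm s v ≤ ρ ^ 2 * hNorm s (v - w) := by
      calc _ = (hNorm s w * hNorm s v) * hNorm s (v - w) := by ring
        _ ≤ (ρ * ρ) * hNorm s (v - w) := by gcongr; exact n1.trans hvρ
        _ = _ := by ring
    have q3 : hNorm s w * hNorm s w * hNorm s (v - w) ≤ ρ ^ 2 * hNorm s (v - w) := by
      calc _ ≤ (ρ * ρ) * hNorm s (v - w) := by gcongr; exact n1.trans hvρ
        _ = _ := by ring
    have hK2 := sq_nonneg K
    nlinarith [mul_le_mul_of_nonneg_left q1 hK2, mul_le_mul_of_nonneg_left q2 hK2,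
      mul_le_mul_of_nonneg_left q3 hK2]

/-! ### Trigonometric polynomials -/

lemma coef_trigSum (S : Finset ℤ) (c : ℤ → ℂ) (n : ℤ) :
    fourierCoeff (⇑(∑ m ∈ S, c m • (fourier m : C(Circ, ℂ)))) n = if n ∈ S then c n else 0 := by
  rw [← coefL_apply, map_sum]
  simp only [coefL_apply, coef_smul, coef_fourier]
  simp

lemma coef_proj (N : ℕ) (v : C(Circ, ℂ)) (n : ℤ) : fourierCoeff (⇑(proj N v)) n
    = if n ∈ Finset.Icc (-(N : ℤ)) N then fourierCoeff v n else 0 :=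
  coef_trigSum _ (fun m => fourierCoeff v m) n

lemma coef_field (s : ℝ) (N : ℕ) (v : C(Circ, ℂ)) (n : ℤ) : fourierCoeff (⇑(field s N v)) n
    = if n ∈ Finset.Icc (-(N : ℤ)) N then
        -(Complex.I * (((|(n : ℝ)| ^ (2 * s) : ℝ) : ℂ) * fourierCoeff v n))
          + Complex.I * fourierCoeff (cubic v) n
      else 0 := by
  rw [field, coef_add, coef_neg, coef_smul, coef_smul, coef_proj, fracLap,
    coef_trigSum _ (fun m : ℤ => ((|(m : ℝ)| ^ (2 * s) : ℝ) : ℂ) * fourierCoeff v m)]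
  split_ifs <;> simp

lemma trigSum_mem (N : ℕ) (c : ℤ → ℂ) :
    ∑ m ∈ Finset.Icc (-(N : ℤ)) N, c m • (fourier m : C(Circ, ℂ)) ∈ trigPoly N := by
  refine Submodule.sum_mem _ fun m hm => Submodule.smul_mem _ _ (Submodule.subset_span ⟨m, ?_, rfl⟩)
  rw [Finset.mem_Icc] at hm
  exact abs_le.mpr hm

lemma proj_mem (N : ℕ) (v : C(Circ, ℂ)) : proj N v ∈ trigPoly N := trigSum_mem N _

lemma field_mem (s : ℝ) (N : ℕ) (v : C(Circ, ℂ)) : field s N v ∈ trigPoly N :=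
  Submodule.add_mem _ (Submodule.neg_mem _ (Submodule.smul_mem _ _ (trigSum_mem N _)))
    (Submodule.smul_mem _ _ (proj_mem N _))

lemma proj_eq_of_mem {N : ℕ} {v : C(Circ, ℂ)} (hv : v ∈ trigPoly N) : proj N v = v := by
  induction hv using Submodule.span_induction with
  | mem x hx =>
    obtain ⟨m, hm, rfl⟩ := hx
    have hm' : m ∈ Finset.Icc (-(N : ℤ)) N := Finset.mem_Icc.mpr (abs_le.mp hm)
    unfold proj
    simp only [coef_fourier, ite_smul, one_smul, zero_smul]
    rw [Finset.sum_ite_eq' (Finset.Icc (-(N : ℤ)) N) m, if_pos hm']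
  | zero => simp only [proj, coef_zero, zero_smul, Finset.sum_const_zero]
  | add x y _ _ hx hy =>
    conv_rhs => rw [← hx, ← hy]
    simp only [proj, coef_add, add_smul, Finset.sum_add_distrib]
  | smul c x _ hx =>
    conv_rhs => rw [← hx]
    simp only [proj, coef_smul, mul_smul, Finset.smul_sum]

lemma coef_of_mem {N : ℕ} {v : C(Circ, ℂ)} (hv : v ∈ trigPoly N) {m : ℤ}
    (hm : m ∉ Finset.Icc (-(N : ℤ)) N) : fourierCoeff v m = 0 := by
  rw [← proj_eq_of_mem hv, coef_proj, if_neg hm]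

lemma trigPoly_ext {N : ℕ} {v w : C(Circ, ℂ)} (hv : v ∈ trigPoly N) (hw : w ∈ trigPoly N)
    (h : ∀ m ∈ Finset.Icc (-(N : ℤ)) N, fourierCoeff v m = fourierCoeff w m) : v = w := by
  rw [← proj_eq_of_mem hv, ← proj_eq_of_mem hw]
  exact Finset.sum_congr rfl fun m hm => by rw [h m hm]

lemma memH_of_mem {N : ℕ} (r : ℝ) {v : C(Circ, ℂ)} (hv : v ∈ trigPoly N) : MemH r v :=
  summable_of_ne_finset_zero (s := Finset.Icc (-(N : ℤ)) N) fun m hm => by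
    rw [coef_of_mem hv hm]; simp

lemma hNorm_sq_of_mem {N : ℕ} (r : ℝ) {v : C(Circ, ℂ)} (hv : v ∈ trigPoly N) :
    hNorm r v ^ 2
      = ∑ m ∈ Finset.Icc (-(N : ℤ)) N, (1 + (m : ℝ) ^ 2) ^ r * ‖fourierCoeff v m‖ ^ 2 := by
  rw [hNorm_sq]
  exact tsum_eq_sum fun m hm => by rw [coef_of_mem hv hm]; simp

lemma eq_zero_of_hNorm {N : ℕ} {v : C(Circ, ℂ)} (hv : v ∈ trigPoly N)
    (h : hNorm 0 v ≤ 0) : v = 0 := by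
  refine trigPoly_ext hv (Submodule.zero_mem _) fun m _ => ?_
  have h0 : hNorm 0 v = 0 := le_antisymm h (hNorm_nonneg _ _)
  have := sum_le_hNorm_sq (memH_of_mem 0 hv) {m}
  rw [h0] at this
  simp only [Real.rpow_zero, Finset.sum_singleton, one_mul] at this
  rw [coef_zero, ← norm_eq_zero]
  nlinarith [norm_nonneg (fourierCoeff v m)]

/-- An inverse inequality: on `S_N`, the `H^s` norm is controlled by the `L²` norm. -/
lemma hNorm_le_of_mem {s : ℝ} (hs1 : s ≤ 1) {N : ℕ} {v : C(Circ, ℂ)} (hv : v ∈ trigPoly N) :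
    hNorm s v ≤ (1 + N) * hNorm 0 v := by
  refine ((memH_of_mem 1 hv).mono hs1).2.trans ?_
  apply le_of_sq_le_sq _ (mul_nonneg (by positivity) (hNorm_nonneg _ _))
  rw [mul_pow, hNorm_sq_of_mem _ hv, hNorm_sq_of_mem _ hv, Finset.mul_sum]
  refine Finset.sum_le_sum fun m hm => ?_
  rw [Real.rpow_one, Real.rpow_zero, one_mul]
  gcongr ?_ * _
  rw [Finset.mem_Icc, ← abs_le] at hm
  have h1 : |(m : ℝ)| ≤ N := by exact_mod_cast hm
  have h2 : (m : ℝ) ^ 2 ≤ (N : ℝ) ^ 2 := by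
    rw [← sq_abs]; exact pow_le_pow_left₀ (abs_nonneg _) h1 2
  nlinarith [Nat.cast_nonneg (α := ℝ) N]

/-- A Bernstein-type inequality: on `S_N`, the maximum norm is controlled by the `L²` norm. -/
lemma norm_apply_sq_le {N : ℕ} (hN : 1 ≤ N) {v : C(Circ, ℂ)} (hv : v ∈ trigPoly N) (x : Circ) :
    ‖v x‖ ^ 2 ≤ 3 * N * hNorm 0 v ^ 2 := by
  have h1 : ‖v x‖ ≤ ∑ m ∈ Finset.Icc (-(N : ℤ)) N, ‖fourierCoeff v m‖ := by
    conv_lhs => rw [← proj_eq_of_mem hv]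
    rw [proj, ContinuousMap.sum_apply]
    refine norm_sum_le_of_le _ fun m _ => ?_
    rw [ContinuousMap.smul_apply, norm_smul, fourier_apply, Circle.norm_coe, mul_one]
  have h2 := sq_sum_le_card_mul_sum_sq (s := Finset.Icc (-(N : ℤ)) N)
    (f := fun m => ‖fourierCoeff v m‖)
  have h3 : ((Finset.Icc (-(N : ℤ)) N).card : ℝ) ≤ 3 * N := by
    rw [Int.card_Icc]
    have : (((N : ℤ) + 1 - -(N : ℤ)).toNat) ≤ 3 * N := by omega
    exact_mod_cast this
  calc ‖v x‖ ^ 2 ≤ (∑ m ∈ Finset.Icc (-(N : ℤ)) N, ‖fourierCoeff v m‖) ^ 2 := by gcongr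
    _ ≤ _ := h2
    _ ≤ 3 * N * ∑ m ∈ Finset.Icc (-(N : ℤ)) N, ‖fourierCoeff v m‖ ^ 2 := by gcongr
    _ = _ := by rw [hNorm_sq_of_mem 0 hv]; simp

lemma norm_cubic_apply (v : C(Circ, ℂ)) (x : Circ) : ‖cubic v x‖ = ‖v x‖ ^ 2 * ‖v x‖ := by
  simp [cubic]

lemma norm_cubic_sub_le {A : ℝ} {v w : C(Circ, ℂ)} {x : Circ} (hv : ‖v x‖ ^ 2 ≤ A)
    (hw : ‖w x‖ ^ 2 ≤ A) : ‖(cubic v - cubic w) x‖ ≤ 3 * A * ‖(v - w) x‖ := by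
  rw [cubic_sub]
  simp only [ContinuousMap.add_apply, ContinuousMap.mul_apply, ContinuousMap.star_apply,
    RCLike.star_def]
  set d := (v - w) x
  have hvw : ‖w x‖ * ‖v x‖ ≤ A := by nlinarith [sq_nonneg (‖w x‖ - ‖v x‖)]
  refine (norm_add_le_of_le le_rfl (norm_add_le _ _)).trans ?_
  simp only [norm_mul, RCLike.norm_conj]
  have hd := norm_nonneg d
  nlinarith [mul_le_mul_of_nonneg_right hv hd, mul_le_mul_of_nonneg_right hw hd,
    mul_le_mul_of_nonneg_right hvw hd]

lemma hNorm_zero_cubic_le {N : ℕ} (hN : 1 ≤ N) {ρ : ℝ} {v : C(Circ, ℂ)} (hv : v ∈ trigPoly N)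
    (hρ : hNorm 0 v ≤ ρ) : hNorm 0 (cubic v) ≤ 3 * N * ρ ^ 2 * hNorm 0 v := by
  refine hNorm_zero_le_of_pointwise (by positivity) fun x => ?_
  rw [norm_cubic_apply]
  gcongr
  refine (norm_apply_sq_le hN hv x).trans ?_
  have := hNorm_nonneg 0 v
  gcongr

lemma hNorm_zero_cubic_sub_le {N : ℕ} (hN : 1 ≤ N) {ρ : ℝ} {v w : C(Circ, ℂ)}
    (hv : v ∈ trigPoly N) (hw : w ∈ trigPoly N) (hvρ : hNorm 0 v ≤ ρ) (hwρ : hNorm 0 w ≤ ρ) :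
    hNorm 0 (cubic v - cubic w) ≤ 9 * N * ρ ^ 2 * hNorm 0 (v - w) := by
  have hA : ∀ v : C(Circ, ℂ), v ∈ trigPoly N → hNorm 0 v ≤ ρ → ∀ x,
      ‖v x‖ ^ 2 ≤ 3 * N * ρ ^ 2 := fun v hv h x => by
    refine (norm_apply_sq_le hN hv x).trans ?_
    have := hNorm_nonneg 0 v
    gcongr
  refine hNorm_zero_le_of_pointwise (by positivity) fun x => ?_
  refine (norm_cubic_sub_le (hA v hv hvρ x) (hA w hw hwρ x)).trans (le_of_eq ?_)
  ring

/-- The pairing of `v ∈ S_N` with `|v|² v` is real: it is the integral of `|v|⁴`. This is the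
source of the conservation of the `L²` norm. -/
lemma im_pairing_cubic {N : ℕ} {v : C(Circ, ℂ)} (hv : v ∈ trigPoly N) :
    (∑ m ∈ Finset.Icc (-(N : ℤ)) N, conj (fourierCoeff v m) * fourierCoeff (cubic v) m).im = 0 := by
  have h1 : star v * cubic v
      = ∑ m ∈ Finset.Icc (-(N : ℤ)) N,
          conj (fourierCoeff v m) • ((fourier (-m) : C(Circ, ℂ)) * cubic v) := by
    conv_lhs => rw [← proj_eq_of_mem hv]
    rw [proj, star_sum, Finset.sum_mul, ← proj, proj_eq_of_mem hv]
    refine Finset.sum_congr rfl fun m _ => ?_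
    ext x
    simp only [ContinuousMap.mul_apply, ContinuousMap.star_apply, ContinuousMap.smul_apply,
      smul_eq_mul, star_mul', RCLike.star_def, fourier_neg]
    ring
  have h2 : fourierCoeff (⇑(star v * cubic v)) 0
      = ∑ m ∈ Finset.Icc (-(N : ℤ)) N, conj (fourierCoeff v m) * fourierCoeff (cubic v) m := by
    rw [h1, ← coefL_apply, map_sum]
    refine Finset.sum_congr rfl fun m _ => ?_
    rw [coefL_apply, coef_smul, coef_fourier_mul, zero_sub, neg_neg]
  have h3 : star (star v * cubic v) = star v * cubic v := by
    rw [cubic_eq]; simp only [star_mul', star_star]; ring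
  rw [← h2, ← Complex.conj_eq_iff_im]
  conv_rhs => rw [← h3, coef_star, neg_zero]

/-- The vector field of the semidiscrete equation is tangent to the spheres of `L²`. -/
lemma re_pairing_field (s : ℝ) {N : ℕ} {v : C(Circ, ℂ)} (hv : v ∈ trigPoly N) :
    (∑ m ∈ Finset.Icc (-(N : ℤ)) N, conj (fourierCoeff v m) * fourierCoeff (field s N v) m).re
      = 0 := by
  have h : ∀ m ∈ Finset.Icc (-(N : ℤ)) N,
      conj (fourierCoeff v m) * fourierCoeff (field s N v) m
        = Complex.I * (conj (fourierCoeff v m) * fourierCoeff (cubic v) m)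
          + ((-(|(m : ℝ)| ^ (2 * s) * ‖fourierCoeff v m‖ ^ 2) : ℝ) : ℂ) * Complex.I := by
    intro m hm
    rw [coef_field, if_pos hm]
    have := Complex.conj_mul' (fourierCoeff v m)
    push_cast
    rw [← this]
    ring
  rw [Finset.sum_congr rfl h, Finset.sum_add_distrib, ← Finset.mul_sum, ← Finset.sum_mul,
    ← Complex.ofReal_sum, Complex.add_re, Complex.I_mul_re, im_pairing_cubic hv,
    Complex.re_ofReal_mul, Complex.I_re]
  simp

/-! ### A single implicit midpoint stage -/

/-- One implicit midpoint stage of length `κ` from `v` to `Y`; a stage of the scheme has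
`κ = k b_j`. -/
def IsStep (s : ℝ) (N : ℕ) (κ : ℝ) (v Y : C(Circ, ℂ)) : Prop :=
  Y = v + (κ : ℂ) • field s N ((2 : ℂ)⁻¹ • (Y + v))

/-- The mean `W` of the end points of a midpoint stage solves this half-step equation. -/
def IsMid (s : ℝ) (N : ℕ) (κ : ℝ) (v W : C(Circ, ℂ)) : Prop :=
  W = v + ((κ / 2 : ℝ) : ℂ) • field s N W

lemma IsStep.isMid {s : ℝ} {N : ℕ} {κ : ℝ} {v Y : C(Circ, ℂ)} (h : IsStep s N κ v Y) :
    IsMid s N κ v ((2 : ℂ)⁻¹ • (Y + v)) := by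
  unfold IsMid
  set F := field s N ((2 : ℂ)⁻¹ • (Y + v)) with hF
  have h' : Y = v + (κ : ℂ) • F := h
  ext x
  have hx := congrArg (fun g : C(Circ, ℂ) => g x) h'
  simp only [ContinuousMap.add_apply, ContinuousMap.smul_apply, smul_eq_mul] at hx ⊢
  push_cast
  rw [hx]; ring

lemma IsMid.isStep {s : ℝ} {N : ℕ} {κ : ℝ} {v W : C(Circ, ℂ)} (h : IsMid s N κ v W) :
    IsStep s N κ v ((2 : ℂ) • W - v) := by
  unfold IsStep
  have e : (2 : ℂ)⁻¹ • ((2 : ℂ) • W - v + v) = W := by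
    rw [sub_add_cancel, smul_smul]; norm_num
  rw [e]
  unfold IsMid at h
  set F := field s N W with hF
  clear_value F
  ext x
  have hx := congrArg (fun g : C(Circ, ℂ) => g x) h
  simp only [ContinuousMap.add_apply, ContinuousMap.sub_apply, ContinuousMap.smul_apply,
    smul_eq_mul] at hx ⊢
  push_cast at hx
  linear_combination (2 : ℂ) * hx

lemma one_le_norm_one_add_I (t : ℝ) : 1 ≤ ‖1 + Complex.I * (t : ℂ)‖ := by
  have := Complex.abs_re_le_norm (1 + Complex.I * (t : ℂ))
  simpa using this

lemma one_add_I_ne_zero (t : ℝ) : 1 + Complex.I * (t : ℂ) ≠ 0 :=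
  norm_pos_iff.mp (zero_lt_one.trans_le (one_le_norm_one_add_I t))

/-- The dispersive part of the half-step equation, treated implicitly, does not amplify a mode,
because `|1 + it| ≥ 1`. -/
lemma norm_mid_le {κ l : ℝ} {w x g : ℂ}
    (h : w = x + ((κ / 2 : ℝ) : ℂ) * (-(Complex.I * ((l : ℂ) * w)) + Complex.I * g)) :
    ‖w‖ ≤ ‖x‖ + |κ| / 2 * ‖g‖ := by
  have e : (1 + Complex.I * ((κ / 2 * l : ℝ) : ℂ)) * w
      = x + ((κ / 2 : ℝ) : ℂ) * (Complex.I * g) := by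
    push_cast at h ⊢
    linear_combination h
  calc ‖w‖ ≤ ‖1 + Complex.I * ((κ / 2 * l : ℝ) : ℂ)‖ * ‖w‖ :=
        le_mul_of_one_le_left (norm_nonneg _) (one_le_norm_one_add_I _)
    _ = ‖x + ((κ / 2 : ℝ) : ℂ) * (Complex.I * g)‖ := by rw [← norm_mul, e]
    _ ≤ ‖x‖ + ‖((κ / 2 : ℝ) : ℂ) * (Complex.I * g)‖ := norm_add_le _ _
    _ = _ := by
      rw [norm_mul, norm_mul, Complex.norm_I, one_mul, Complex.norm_real, Real.norm_eq_abs, abs_div,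
        abs_two]

/-- The Cayley transform `(1 - it) / (1 + it)` of the dispersive part is unitary. -/
lemma norm_step_le {κ l : ℝ} {y x g : ℂ}
    (h : y = x + (κ : ℂ) * (-(Complex.I * ((l : ℂ) * ((2 : ℂ)⁻¹ * (y + x)))) + Complex.I * g)) :
    ‖y‖ ≤ ‖x‖ + |κ| * ‖g‖ := by
  set z : ℂ := 1 + Complex.I * ((κ / 2 * l : ℝ) : ℂ) with hz
  have hz1 : 1 ≤ ‖z‖ := one_le_norm_one_add_I _
  have e : z * y = conj z * x + (κ : ℂ) * (Complex.I * g) := by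
    rw [hz, map_add, map_mul, Complex.conj_ofReal, Complex.conj_I, map_one]
    push_cast
    linear_combination h
  have h1 : ‖z‖ * ‖y‖ ≤ ‖z‖ * ‖x‖ + |κ| * ‖g‖ := by
    rw [← norm_mul, e]
    refine (norm_add_le _ _).trans (le_of_eq ?_)
    rw [norm_mul, norm_mul, norm_mul, Complex.norm_I, one_mul, Complex.norm_real,
      Real.norm_eq_abs, RCLike.norm_conj]
  have h2 : ‖z‖ * ‖y‖ ≤ ‖z‖ * (‖x‖ + |κ| * ‖g‖) := by
    rw [mul_add]
    refine h1.trans (add_le_add le_rfl (le_mul_of_one_le_left (by positivity) hz1))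
  exact le_of_mul_le_mul_left h2 (zero_lt_one.trans_le hz1)

lemma IsMid.mem {s : ℝ} {N : ℕ} {κ : ℝ} {v W : C(Circ, ℂ)} (h : IsMid s N κ v W)
    (hv : v ∈ trigPoly N) : W ∈ trigPoly N := by
  rw [h]; exact Submodule.add_mem _ hv (Submodule.smul_mem _ _ (field_mem s N W))

lemma IsMid.coef {s : ℝ} {N : ℕ} {κ : ℝ} {v W : C(Circ, ℂ)} (h : IsMid s N κ v W) {m : ℤ}
    (hm : m ∈ Finset.Icc (-(N : ℤ)) N) :
    fourierCoeff W m = fourierCoeff v m + ((κ / 2 : ℝ) : ℂ) *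
      (-(Complex.I * (((|(m : ℝ)| ^ (2 * s) : ℝ) : ℂ) * fourierCoeff W m))
        + Complex.I * fourierCoeff (cubic W) m) := by
  conv_lhs => rw [h]
  rw [coef_add, coef_smul, coef_field, if_pos hm]

lemma IsStep.coef {s : ℝ} {N : ℕ} {κ : ℝ} {v Y : C(Circ, ℂ)} (h : IsStep s N κ v Y) {m : ℤ}
    (hm : m ∈ Finset.Icc (-(N : ℤ)) N) :
    fourierCoeff Y m = fourierCoeff v m + (κ : ℂ) *
      (-(Complex.I * (((|(m : ℝ)| ^ (2 * s) : ℝ) : ℂ) *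
          ((2 : ℂ)⁻¹ * (fourierCoeff Y m + fourierCoeff v m))))
        + Complex.I * fourierCoeff (cubic ((2 : ℂ)⁻¹ • (Y + v))) m) := by
  conv_lhs => rw [h]
  rw [coef_add, coef_smul, coef_field, if_pos hm, coef_smul, coef_add]

/-- Bound of the difference of two solutions of the half-step equation. -/
lemma IsMid.hNorm_sub_le {s r : ℝ} {N : ℕ} {κ : ℝ} {v v' W W' : C(Circ, ℂ)}
    (hv : v ∈ trigPoly N) (hv' : v' ∈ trigPoly N) (h : IsMid s N κ v W) (h' : IsMid s N κ v' W')
    (hc : MemH r (cubic W - cubic W')) :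
    hNorm r (W - W') ≤ hNorm r (v - v') + |κ| / 2 * hNorm r (cubic W - cubic W') := by
  refine (hNorm_le_add (by positivity)
    (memH_of_mem r (Submodule.sub_mem _ hv hv')) hc fun m => ?_).2
  by_cases hm : m ∈ Finset.Icc (-(N : ℤ)) N
  · apply norm_mid_le (l := |(m : ℝ)| ^ (2 * s))
    rw [coef_sub, coef_sub, coef_sub]
    linear_combination h.coef hm - h'.coef hm
  · rw [coef_of_mem (Submodule.sub_mem _ (h.mem hv) (h'.mem hv')) hm, norm_zero]; positivity

/-- Bound of the difference of two midpoint stages. -/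
lemma IsStep.hNorm_sub_le {s r : ℝ} {N : ℕ} {κ : ℝ} {v v' Y Y' : C(Circ, ℂ)}
    (hv : v ∈ trigPoly N) (hv' : v' ∈ trigPoly N) (hY : Y ∈ trigPoly N) (hY' : Y' ∈ trigPoly N)
    (h : IsStep s N κ v Y) (h' : IsStep s N κ v' Y')
    (hc : MemH r (cubic ((2 : ℂ)⁻¹ • (Y + v)) - cubic ((2 : ℂ)⁻¹ • (Y' + v')))) :
    hNorm r (Y - Y') ≤ hNorm r (v - v')
      + |κ| * hNorm r (cubic ((2 : ℂ)⁻¹ • (Y + v)) - cubic ((2 : ℂ)⁻¹ • (Y' + v'))) := by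
  refine (hNorm_le_add (by positivity)
    (memH_of_mem r (Submodule.sub_mem _ hv hv')) hc fun m => ?_).2
  by_cases hm : m ∈ Finset.Icc (-(N : ℤ)) N
  · apply norm_step_le (l := |(m : ℝ)| ^ (2 * s))
    rw [coef_sub, coef_sub, coef_sub]
    linear_combination h.coef hm - h'.coef hm
  · rw [coef_of_mem (Submodule.sub_mem _ hY hY') hm, norm_zero]; positivity

/-- A midpoint stage conserves the `L²` norm. -/
lemma IsStep.hNorm_zero_eq {s : ℝ} {N : ℕ} {κ : ℝ} {v Y : C(Circ, ℂ)}
    (hv : v ∈ trigPoly N) (hY : Y ∈ trigPoly N) (h : IsStep s N κ v Y) :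
    hNorm 0 Y = hNorm 0 v := by
  have hW : (2 : ℂ)⁻¹ • (Y + v) ∈ trigPoly N := Submodule.smul_mem _ _ (Submodule.add_mem _ hY hv)
  set W := (2 : ℂ)⁻¹ • (Y + v) with hWdef
  have h0 := re_pairing_field s hW
  have hm : ∀ m, ‖fourierCoeff Y m‖ ^ 2 - ‖fourierCoeff v m‖ ^ 2
      = 2 * κ * (conj (fourierCoeff W m) * fourierCoeff (field s N W) m).re := by
    intro m
    have e1 : fourierCoeff Y m = fourierCoeff v m + (κ : ℂ) * fourierCoeff (field s N W) m := by
      conv_lhs => rw [h]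
      rw [coef_add, coef_smul]
    have e2 : fourierCoeff W m = (2 : ℂ)⁻¹ * (fourierCoeff Y m + fourierCoeff v m) := by
      rw [hWdef, coef_smul, coef_add]
    have e3 : ((2 * κ : ℝ) : ℂ) * (conj (fourierCoeff W m) * fourierCoeff (field s N W) m)
        = conj (fourierCoeff Y m + fourierCoeff v m) * (fourierCoeff Y m - fourierCoeff v m) := by
      rw [e2, map_mul, show conj ((2 : ℂ)⁻¹) = 2⁻¹ by rw [map_inv₀, map_ofNat]]
      push_cast
      linear_combination (-(conj (fourierCoeff Y m + fourierCoeff v m))) * e1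
    rw [← Complex.re_ofReal_mul, e3, ← Complex.normSq_eq_norm_sq, ← Complex.normSq_eq_norm_sq,
      Complex.normSq_apply, Complex.normSq_apply]
    simp only [map_add, Complex.mul_re, Complex.add_re, Complex.conj_re, Complex.sub_re,
      Complex.add_im, Complex.conj_im, Complex.sub_im]
    ring
  have h2 : hNorm 0 Y ^ 2 - hNorm 0 v ^ 2 = 0 := by
    rw [hNorm_sq_of_mem 0 hY, hNorm_sq_of_mem 0 hv, ← Finset.sum_sub_distrib]
    simp only [Real.rpow_zero, one_mul, hm]
    rw [← Finset.mul_sum, ← Complex.re_sum, h0, mul_zero]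
  exact (pow_left_inj₀ (hNorm_nonneg _ _) (hNorm_nonneg _ _) two_ne_zero).mp (sub_eq_zero.mp h2)

lemma hNorm_half_add_le {N : ℕ} {r ρ : ℝ} {v Y : C(Circ, ℂ)} (hv : v ∈ trigPoly N)
    (hY : Y ∈ trigPoly N) (h : hNorm r v ≤ ρ) (h' : hNorm r Y ≤ ρ) :
    hNorm r ((2 : ℂ)⁻¹ • (Y + v)) ≤ ρ := by
  have h1 := (memH_of_mem r hY).add (memH_of_mem r hv)
  have h2 := (hNorm_smul_le (2 : ℂ)⁻¹ h1.1).2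
  rw [norm_inv, Complex.norm_ofNat] at h2
  linarith [h1.2]

/-- Uniqueness of a midpoint stage under the smallness condition: by conservation, the means of two
stages lie in the `L²` ball of radius `‖v‖₀`, on which the half-step map contracts. -/
lemma IsStep.unique {s : ℝ} {N : ℕ} (hN : 1 ≤ N) {κ : ℝ} {v Y Y' : C(Circ, ℂ)}
    (hv : v ∈ trigPoly N) (hY : Y ∈ trigPoly N) (hY' : Y' ∈ trigPoly N)
    (hsmall : N * |κ| * hNorm 0 v ^ 2 ≤ 1 / 18)
    (h : IsStep s N κ v Y) (h' : IsStep s N κ v Y') : Y = Y' := by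
  have hW : (2 : ℂ)⁻¹ • (Y + v) ∈ trigPoly N := Submodule.smul_mem _ _ (Submodule.add_mem _ hY hv)
  have hW' : (2 : ℂ)⁻¹ • (Y' + v) ∈ trigPoly N :=
    Submodule.smul_mem _ _ (Submodule.add_mem _ hY' hv)
  have b := hNorm_half_add_le hv hY le_rfl (h.hNorm_zero_eq hv hY).le
  have b' := hNorm_half_add_le hv hY' le_rfl (h'.hNorm_zero_eq hv hY').le
  have k1 := IsMid.hNorm_sub_le hv hv h.isMid h'.isMid (memH_zero _)
  have k2 := hNorm_zero_cubic_sub_le hN hW hW' b b'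
  have m1 := h.isMid
  have m2 := h'.isMid
  set W := (2 : ℂ)⁻¹ • (Y + v)
  set W' := (2 : ℂ)⁻¹ • (Y' + v)
  have hz : hNorm 0 (W - W') ≤ 0 := by
    rw [sub_self, hNorm_of_zero, zero_add] at k1
    have k3 := mul_le_mul_of_nonneg_left k2 (show 0 ≤ |κ| / 2 by positivity)
    have k4 := mul_le_mul_of_nonneg_right hsmall (hNorm_nonneg 0 (W - W'))
    nlinarith
  have e : W = W' := sub_eq_zero.mp (eq_zero_of_hNorm (Submodule.sub_mem _ hW hW') hz)
  rw [h, h']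
  change v + (κ : ℂ) • field s N W = v + (κ : ℂ) • field s N W'
  rw [e]

/-! ### Existence of the stages -/

/-- The trigonometric polynomial with given coefficients, as a function on a Hilbert space. -/
def synth (N : ℕ) (a : EuclideanSpace ℂ (Finset.Icc (-(N : ℤ)) N)) : C(Circ, ℂ) :=
  ∑ m ∈ Finset.Icc (-(N : ℤ)) N, (if h : m ∈ Finset.Icc (-(N : ℤ)) N then a ⟨m, h⟩ else 0) •
    (fourier m : C(Circ, ℂ))

lemma synth_mem (N : ℕ) (a : EuclideanSpace ℂ (Finset.Icc (-(N : ℤ)) N)) :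
    synth N a ∈ trigPoly N := trigSum_mem N _

lemma coef_synth (N : ℕ) (a : EuclideanSpace ℂ (Finset.Icc (-(N : ℤ)) N))
    (m : Finset.Icc (-(N : ℤ)) N) : fourierCoeff (synth N a) m = a m := by
  unfold synth
  rw [coef_trigSum _ (fun m : ℤ => if h : m ∈ Finset.Icc (-(N : ℤ)) N then a ⟨m, h⟩ else 0),
    if_pos m.2, dif_pos m.2]

lemma hNorm_sq_synth (r : ℝ) (N : ℕ) (a : EuclideanSpace ℂ (Finset.Icc (-(N : ℤ)) N)) :
    hNorm r (synth N a) ^ 2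
      = ∑ m : Finset.Icc (-(N : ℤ)) N, (1 + ((m : ℤ) : ℝ) ^ 2) ^ r * ‖a m‖ ^ 2 := by
  rw [hNorm_sq_of_mem r (synth_mem N a), ← Finset.sum_coe_sort]
  simp_rw [coef_synth]

lemma synth_sub (N : ℕ) (a b : EuclideanSpace ℂ (Finset.Icc (-(N : ℤ)) N)) :
    synth N (a - b) = synth N a - synth N b := by
  refine trigPoly_ext (synth_mem N _) (Submodule.sub_mem _ (synth_mem N _) (synth_mem N _))
    fun m hm => ?_
  rw [coef_sub, coef_synth N _ ⟨m, hm⟩, coef_synth N _ ⟨m, hm⟩, coef_synth N _ ⟨m, hm⟩]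
  rfl

lemma hNorm_zero_synth (N : ℕ) (a : EuclideanSpace ℂ (Finset.Icc (-(N : ℤ)) N)) :
    hNorm 0 (synth N a) = ‖a‖ := by
  rw [← pow_left_inj₀ (hNorm_nonneg _ _) (norm_nonneg _) two_ne_zero, hNorm_sq_synth,
    EuclideanSpace.norm_sq_eq]
  simp

lemma continuous_hNorm_synth (r : ℝ) (N : ℕ) : Continuous fun a => hNorm r (synth N a) := by
  have : (fun a => hNorm r (synth N a)) = fun a : EuclideanSpace ℂ (Finset.Icc (-(N : ℤ)) N) =>
      Real.sqrt (∑ m : Finset.Icc (-(N : ℤ)) N, (1 + ((m : ℤ) : ℝ) ^ 2) ^ r * ‖a m‖ ^ 2) := by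
    ext a
    rw [← hNorm_sq_synth, Real.sqrt_sq (hNorm_nonneg _ _)]
  rw [this]
  fun_prop

/-- The map whose fixed points are the solutions of the half-step equation: the linear dispersive
part is inverted, the nonlinearity is explicit. -/
def midMap (s : ℝ) (N : ℕ) (κ : ℝ) (v : C(Circ, ℂ))
    (a : EuclideanSpace ℂ (Finset.Icc (-(N : ℤ)) N)) :
    EuclideanSpace ℂ (Finset.Icc (-(N : ℤ)) N) :=
  WithLp.toLp 2 fun m => (1 + Complex.I * ((κ / 2 * |((m : ℤ) : ℝ)| ^ (2 * s) : ℝ) : ℂ))⁻¹ *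
    (fourierCoeff v m + ((κ / 2 : ℝ) : ℂ) * (Complex.I * fourierCoeff (cubic (synth N a)) m))

lemma midMap_apply (s : ℝ) (N : ℕ) (κ : ℝ) (v : C(Circ, ℂ))
    (a : EuclideanSpace ℂ (Finset.Icc (-(N : ℤ)) N)) (m : Finset.Icc (-(N : ℤ)) N) :
    midMap s N κ v a m = fourierCoeff v m + ((κ / 2 : ℝ) : ℂ) *
      (-(Complex.I * (((|((m : ℤ) : ℝ)| ^ (2 * s) : ℝ) : ℂ) * midMap s N κ v a m))
        + Complex.I * fourierCoeff (cubic (synth N a)) m) := by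
  have h := one_add_I_ne_zero (κ / 2 * |((m : ℤ) : ℝ)| ^ (2 * s))
  have e : (1 + Complex.I * ((κ / 2 * |((m : ℤ) : ℝ)| ^ (2 * s) : ℝ) : ℂ)) * midMap s N κ v a m
      = fourierCoeff v m + ((κ / 2 : ℝ) : ℂ) *
        (Complex.I * fourierCoeff (cubic (synth N a)) m) := by
    unfold midMap
    rw [PiLp.toLp_apply, mul_inv_cancel_left₀ h]
  rw [Complex.ofReal_mul (κ / 2)] at e
  linear_combination e

lemma hNorm_midMap_le {s r : ℝ} {N : ℕ} {κ : ℝ} {v : C(Circ, ℂ)} (hv : v ∈ trigPoly N)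
    (a : EuclideanSpace ℂ (Finset.Icc (-(N : ℤ)) N)) (hc : MemH r (cubic (synth N a))) :
    hNorm r (synth N (midMap s N κ v a))
      ≤ hNorm r v + |κ| / 2 * hNorm r (cubic (synth N a)) := by
  refine (hNorm_le_add (by positivity) (memH_of_mem r hv) hc fun m => ?_).2
  by_cases hm : m ∈ Finset.Icc (-(N : ℤ)) N
  · rw [coef_synth N _ ⟨m, hm⟩]
    exact norm_mid_le (l := |(m : ℝ)| ^ (2 * s)) (midMap_apply s N κ v a ⟨m, hm⟩)
  · rw [coef_of_mem (synth_mem N _) hm, norm_zero]; positivity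

lemma dist_midMap_le {s : ℝ} {N : ℕ} {κ : ℝ} {v : C(Circ, ℂ)}
    (a a' : EuclideanSpace ℂ (Finset.Icc (-(N : ℤ)) N)) :
    dist (midMap s N κ v a) (midMap s N κ v a')
      ≤ |κ| / 2 * hNorm 0 (cubic (synth N a) - cubic (synth N a')) := by
  rw [dist_eq_norm, ← hNorm_zero_synth]
  refine (hNorm_le_mul (by positivity) (memH_zero _) fun m => ?_).2
  by_cases hm : m ∈ Finset.Icc (-(N : ℤ)) N
  · rw [coef_synth N _ ⟨m, hm⟩, PiLp.sub_apply]
    have h1 := midMap_apply s N κ v a ⟨m, hm⟩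
    have h2 := midMap_apply s N κ v a' ⟨m, hm⟩
    have := norm_mid_le (κ := κ) (l := |(m : ℝ)| ^ (2 * s)) (x := 0)
      (w := midMap s N κ v a ⟨m, hm⟩ - midMap s N κ v a' ⟨m, hm⟩)
      (g := fourierCoeff (⇑(cubic (synth N a) - cubic (synth N a'))) m)
      (by rw [coef_sub]; linear_combination h1 - h2)
    simpa using this
  · rw [coef_of_mem (synth_mem N _) hm, norm_zero]; positivity

/-- Existence of a solution of the half-step equation under the smallness condition. The fixed
point iteration, started at zero, contracts in the `L²` norm on a ball, and it stays in every
ball of `H^s` which it maps into itself. -/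
lemma exists_mid {s : ℝ} {N : ℕ} (hN : 1 ≤ N) {κ : ℝ} {v : C(Circ, ℂ)}
    (hv : v ∈ trigPoly N) (hsmall : N * |κ| * hNorm 0 v ^ 2 ≤ 1 / 18) {K : ℝ} (hK : 0 ≤ K)
    (hcub : ∀ v : C(Circ, ℂ), MemH s v →
      MemH s (cubic v) ∧ hNorm s (cubic v) ≤ K * hNorm s v ^ 3) :
    ∃ W, IsMid s N κ v W ∧
      ∀ ρ, 0 ≤ ρ → hNorm s v + |κ| / 2 * (K * ρ ^ 3) ≤ ρ → hNorm s W ≤ ρ := by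
  set R := hNorm 0 v with hR
  have hR0 : 0 ≤ R := hNorm_nonneg _ _
  set G := midMap s N κ v with hG
  -- on the ball of radius `3R/2` the smallness condition gives the contraction factor `9/16`
  set S : Set (EuclideanSpace ℂ (Finset.Icc (-(N : ℤ)) N)) := Metric.closedBall 0 (3 / 2 * R)
  have memS : ∀ a, a ∈ S ↔ hNorm 0 (synth N a) ≤ 3 / 2 * R := fun a => by
    rw [hNorm_zero_synth]; exact mem_closedBall_zero_iff
  have hmaps : Set.MapsTo G S S := by
    intro a ha
    rw [memS] at ha ⊢
    refine (hNorm_midMap_le hv a (memH_zero _)).trans ?_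
    have h1 := hNorm_zero_cubic_le hN (synth_mem N a) ha
    have h2 : hNorm 0 (cubic (synth N a)) ≤ 3 * N * (3 / 2 * R) ^ 2 * (3 / 2 * R) :=
      h1.trans (by gcongr)
    have h3 := mul_le_mul_of_nonneg_left h2 (show 0 ≤ |κ| / 2 by positivity)
    have h4 := mul_le_mul_of_nonneg_right hsmall hR0
    nlinarith
  have hcontr : ContractingWith (9 / 16) (hmaps.restrict G S S) := by
    refine ⟨by rw [← NNReal.coe_lt_coe]; push_cast; norm_num,
      LipschitzWith.of_dist_le_mul fun a a' => ?_⟩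
    have ha := (memS _).mp a.2
    have ha' := (memS _).mp a'.2
    refine (dist_midMap_le a.1 a'.1).trans ?_
    have h1 := hNorm_zero_cubic_sub_le hN (synth_mem N _) (synth_mem N _) ha ha'
    rw [← synth_sub, hNorm_zero_synth, ← dist_eq_norm] at h1
    have h3 := mul_le_mul_of_nonneg_left h1 (show 0 ≤ |κ| / 2 by positivity)
    have h4 := mul_le_mul_of_nonneg_right hsmall (dist_nonneg (x := a.1) (y := a'.1))
    rw [Subtype.dist_eq]
    push_cast
    nlinarith
  have h0S : (0 : EuclideanSpace ℂ (Finset.Icc (-(N : ℤ)) N)) ∈ S :=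
    Metric.mem_closedBall_self (by positivity)
  obtain ⟨y, -, hfix, hlim, -⟩ := hcontr.exists_fixedPoint'
    Metric.isClosed_closedBall.isComplete hmaps h0S (edist_ne_top _ _)
  refine ⟨synth N y, ?_, fun ρ hρ hle => ?_⟩
  · refine trigPoly_ext (synth_mem N y)
      (Submodule.add_mem _ hv (Submodule.smul_mem _ _ (field_mem s N _))) fun m hm => ?_
    rw [coef_add, coef_smul, coef_field, if_pos hm, coef_synth N y ⟨m, hm⟩]
    have := midMap_apply s N κ v y ⟨m, hm⟩
    rw [← hG, hfix] at this
    exact this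
  · have hit : ∀ n, hNorm s (synth N (G^[n] 0)) ≤ ρ := by
      intro n
      induction n with
      | zero =>
        refine le_trans (le_of_eq ?_) hρ
        rw [Function.iterate_zero, id, eq_zero_of_hNorm (synth_mem N 0), hNorm_of_zero]
        rw [hNorm_zero_synth, norm_zero]
      | succ n ih =>
        rw [Function.iterate_succ_apply']
        obtain ⟨c1, c2⟩ := hcub _ (memH_of_mem s (synth_mem N (G^[n] 0)))
        refine (hNorm_midMap_le hv _ c1).trans (le_trans ?_ hle)
        have := hNorm_nonneg s (synth N (G^[n] 0))
        have h5 : hNorm s (cubic (synth N (G^[n] 0))) ≤ K * ρ ^ 3 := c2.trans (by gcongr)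
        gcongr
    exact le_of_tendsto (((continuous_hNorm_synth s N).tendsto y).comp hlim)
      (Eventually.of_forall hit)

/-- Existence of a midpoint stage, with the `H^s` bound that holds for short stages: the ball of
radius `2β` is invariant for the half-step map, so `Y = 2W - v` is bounded by `5β`. -/
lemma exists_step {s : ℝ} {N : ℕ} (hN : 1 ≤ N) {κ : ℝ} {v : C(Circ, ℂ)}
    (hv : v ∈ trigPoly N) (hsmall : N * |κ| * hNorm 0 v ^ 2 ≤ 1 / 18) {K : ℝ} (hK : 0 ≤ K)
    (hcub : ∀ v : C(Circ, ℂ), MemH s v →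
      MemH s (cubic v) ∧ hNorm s (cubic v) ≤ K * hNorm s v ^ 3) :
    ∃ Y ∈ trigPoly N, IsStep s N κ v Y ∧
      ∀ β, hNorm s v ≤ β → 4 * |κ| * K * β ^ 2 ≤ 1 → hNorm s Y ≤ 5 * β := by
  obtain ⟨W, hW, hb⟩ := exists_mid hN hv hsmall hK hcub
  have hWm := hW.mem hv
  refine ⟨(2 : ℂ) • W - v, Submodule.sub_mem _ (Submodule.smul_mem _ _ hWm) hv, hW.isStep,
    fun β hβ hsm => ?_⟩
  have hβ0 : 0 ≤ β := (hNorm_nonneg _ _).trans hβ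
  have h1 := hb (2 * β) (by positivity) (by
    have := mul_le_mul_of_nonneg_right hsm hβ0
    nlinarith)
  have h2 := hNorm_smul_le (2 : ℂ) (memH_of_mem s hWm)
  have h3 := (h2.1.sub (memH_of_mem s hv)).2
  rw [Complex.norm_ofNat] at h2
  linarith [h2.2]

/-- `H^s` stability of a midpoint stage whose end points lie in a ball on which the nonlinearity has
the Lipschitz constant `L`. -/
lemma IsStep.stability {s : ℝ} {N : ℕ} {κ : ℝ} {v v' Y Y' : C(Circ, ℂ)}
    (hv : v ∈ trigPoly N) (hv' : v' ∈ trigPoly N) (hY : Y ∈ trigPoly N) (hY' : Y' ∈ trigPoly N)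
    (h : IsStep s N κ v Y) (h' : IsStep s N κ v' Y') {L ρ : ℝ} (hL : 0 ≤ L) (hκ : |κ| * L ≤ 1)
    (hlip : ∀ w w' : C(Circ, ℂ), MemH s w → MemH s w' → hNorm s w ≤ ρ → hNorm s w' ≤ ρ →
        MemH s (cubic w - cubic w') ∧ hNorm s (cubic w - cubic w') ≤ L * hNorm s (w - w'))
    (b1 : hNorm s v ≤ ρ) (b2 : hNorm s v' ≤ ρ) (b3 : hNorm s Y ≤ ρ) (b4 : hNorm s Y' ≤ ρ) :
    hNorm s (Y - Y') ≤ Real.exp (2 * L * |κ|) * hNorm s (v - v') := by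
  have hW : (2 : ℂ)⁻¹ • (Y + v) ∈ trigPoly N := Submodule.smul_mem _ _ (Submodule.add_mem _ hY hv)
  have hW' : (2 : ℂ)⁻¹ • (Y' + v') ∈ trigPoly N :=
    Submodule.smul_mem _ _ (Submodule.add_mem _ hY' hv')
  obtain ⟨c1, c2⟩ := hlip _ _ (memH_of_mem s hW) (memH_of_mem s hW')
    (hNorm_half_add_le hv hY b1 b3) (hNorm_half_add_le hv' hY' b2 b4)
  have m1 := IsMid.hNorm_sub_le hv hv' h.isMid h'.isMid c1
  have m2 := IsStep.hNorm_sub_le hv hv' hY hY' h h' c1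
  set x := hNorm s ((2 : ℂ)⁻¹ • (Y + v) - (2 : ℂ)⁻¹ • (Y' + v'))
  set d := hNorm s (v - v')
  have hd : 0 ≤ d := hNorm_nonneg _ _
  have hx0 : 0 ≤ x := hNorm_nonneg _ _
  have hx : x ≤ 2 * d := by
    have e1 := mul_le_mul_of_nonneg_left c2 (show 0 ≤ |κ| / 2 by positivity)
    have e2 := mul_le_mul_of_nonneg_right hκ hx0
    nlinarith
  calc hNorm s (Y - Y') ≤ d + |κ| * (L * (2 * d)) := by
        refine m2.trans ?_
        gcongr
        exact c2.trans (by gcongr)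
    _ = (2 * L * |κ| + 1) * d := by ring
    _ ≤ _ := by gcongr; exact Real.add_one_le_exp _

/-! ### Systems of stages and the fully discrete scheme -/

/-- Finite dependent choice along a family of relations that preserve `P`. -/
lemma exists_chain {X : Type*} {n : ℕ} (Rel : Fin n → X → X → Prop) (P : X → Prop)
    (hex : ∀ j x, P x → ∃ y, P y ∧ Rel j x y) (x₀ : X) (h₀ : P x₀) :
    ∃ Y : Fin (n + 1) → X, Y 0 = x₀ ∧ (∀ j, P (Y j)) ∧
      ∀ j : Fin n, Rel j (Y j.castSucc) (Y j.succ) := by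
  induction n generalizing x₀ with
  | zero => exact ⟨fun _ => x₀, rfl, fun _ => h₀, fun j => j.elim0⟩
  | succ n ih =>
    obtain ⟨y, hy, hrel⟩ := hex 0 x₀ h₀
    obtain ⟨Y, h1, h2, h3⟩ := ih (fun j => Rel j.succ) (fun j => hex j.succ) y hy
    refine ⟨Fin.cons x₀ Y, rfl, fun j => ?_, fun j => ?_⟩
    · refine Fin.cases ?_ (fun i => ?_) j
      · exact h₀
      · exact h2 i
    · refine Fin.cases ?_ (fun i => ?_) j
      · simpa [h1] using hrel
      · rw [Fin.castSucc_succ, Fin.cons_succ, Fin.cons_succ]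
        exact h3 i

section Stages

variable {s : ℝ} {N : ℕ} {k : ℝ} {q : ℕ} {b : Fin q → ℝ} {v : C(Circ, ℂ)}

lemma IsStages.isStep {Y : Fin (q + 1) → C(Circ, ℂ)} (h : IsStages s N k b v Y) (j : Fin q) :
    IsStep s N (k * b j) (Y j.castSucc) (Y j.succ) := h.step j

lemma IsStages.hNorm_zero_eq {Y : Fin (q + 1) → C(Circ, ℂ)} (h : IsStages s N k b v Y)
    (j : Fin (q + 1)) : hNorm 0 (Y j) = hNorm 0 v := by
  induction j using Fin.induction with
  | zero => rw [h.start]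
  | succ j ih => rw [(h.isStep j).hNorm_zero_eq (h.mem _) (h.mem _), ih]

lemma IsStages.unique (hN : 1 ≤ N) (hsmall : ∀ j, N * |k * b j| * hNorm 0 v ^ 2 ≤ 1 / 18)
    {Y Y' : Fin (q + 1) → C(Circ, ℂ)} (h : IsStages s N k b v Y) (h' : IsStages s N k b v Y') :
    Y = Y' := by
  ext1 j
  induction j using Fin.induction with
  | zero => rw [h.start, h'.start]
  | succ j ih =>
    have h2 := h'.isStep j
    rw [← ih] at h2
    exact IsStep.unique hN (h.mem _) (h.mem _) (h'.mem _)
      (by rw [h.hNorm_zero_eq]; exact hsmall j) (h.isStep j) h2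

/-- Existence of a system of stages. Each stage enlarges an `H^s` bound at most by the factor `5`,
whence the bound `5 ^ q * β` for all stages. -/
lemma exists_stages (hN : 1 ≤ N) (hv : v ∈ trigPoly N)
    (hsmall : ∀ j, N * |k * b j| * hNorm 0 v ^ 2 ≤ 1 / 18) {K : ℝ} (hK : 0 ≤ K)
    (hcub : ∀ v : C(Circ, ℂ), MemH s v →
      MemH s (cubic v) ∧ hNorm s (cubic v) ≤ K * hNorm s v ^ 3) :
    ∃ Y : Fin (q + 1) → C(Circ, ℂ), IsStages s N k b v Y ∧
      ∀ β, 0 ≤ β → hNorm s v ≤ β → (∀ j, 4 * |k * b j| * K * (5 ^ q * β) ^ 2 ≤ 1) →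
        ∀ j, hNorm s (Y j) ≤ 5 ^ q * β := by
  obtain ⟨Y, h0, h1, h2⟩ := exists_chain
    (fun (j : Fin q) (x y : C(Circ, ℂ)) => IsStep s N (k * b j) x y ∧
      ∀ β, hNorm s x ≤ β → 4 * |k * b j| * K * β ^ 2 ≤ 1 → hNorm s y ≤ 5 * β)
    (fun x => x ∈ trigPoly N ∧ hNorm 0 x = hNorm 0 v)
    (fun j x hx => by
      obtain ⟨Y, hY, hstep, hb⟩ := exists_step hN hx.1 (by rw [hx.2]; exact hsmall j) hK hcub
      exact ⟨Y, ⟨hY, (hstep.hNorm_zero_eq hx.1 hY).trans hx.2⟩, hstep, hb⟩)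
    v ⟨hv, rfl⟩
  refine ⟨Y, ⟨fun j => (h1 j).1, h0, fun j => (h2 j).1⟩, fun β hβ hvβ hsm => ?_⟩
  have mono : ∀ j : ℕ, j ≤ q → (5 : ℝ) ^ j * β ≤ 5 ^ q * β := fun j hj => by
    gcongr
    norm_num
  have key : ∀ j : Fin (q + 1), hNorm s (Y j) ≤ 5 ^ (j : ℕ) * β := by
    intro j
    induction j using Fin.induction with
    | zero => simpa [h0] using hvβ
    | succ j ih =>
      have := (h2 j).2 _ ih (le_trans (by
        have := mono j j.2.le
        simp only [Fin.val_castSucc]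
        gcongr) (hsm j))
      refine this.trans (le_of_eq ?_)
      rw [Fin.val_succ, Fin.val_castSucc, pow_succ]; ring
  exact fun j => (key j).trans (mono j (Nat.lt_succ_iff.mp j.2))

end Stages

/-- Uniform `H^s` stability of one step of the scheme on a ball of `H^s`, for short steps. -/
lemma exists_one_step_const {s : ℝ} (hs : 1 / 2 < s) (hs1 : s ≤ 1) {q : ℕ} (b : Fin q → ℝ)
    {β : ℝ} (hβ : 0 ≤ β) :
    ∃ k₀ c : ℝ, 0 < k₀ ∧ 0 ≤ c ∧ ∀ (N : ℕ) (k : ℝ), 1 ≤ N → 0 < k → k ≤ k₀ →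
      ∀ (v v' : C(Circ, ℂ)) (Y Y' : Fin (q + 1) → C(Circ, ℂ)),
        (∀ j, N * |k * b j| * hNorm 0 v ^ 2 ≤ 1 / 18) →
        (∀ j, N * |k * b j| * hNorm 0 v' ^ 2 ≤ 1 / 18) →
        hNorm s v ≤ β → hNorm s v' ≤ β → IsStages s N k b v Y → IsStages s N k b v' Y' →
        hNorm s (Y (Fin.last q) - Y' (Fin.last q)) ≤ Real.exp (c * k) * hNorm s (v - v') := by
  obtain ⟨K, hK, hcub, hlip⟩ := exists_cubic_const hs hs1
  set ρ : ℝ := 5 ^ q * β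
  set L : ℝ := K * ρ ^ 2
  have hL : 0 ≤ L := by positivity
  set B : ℝ := ∑ j, |b j|
  have hB : 0 ≤ B := Finset.sum_nonneg fun j _ => abs_nonneg _
  have hbB : ∀ j, |b j| ≤ B := fun j =>
    Finset.single_le_sum (f := fun j => |b j|) (fun j _ => abs_nonneg _) (Finset.mem_univ j)
  refine ⟨1 / (4 * (B + 1) * (L + 1)), q * (2 * L * B), by positivity, by positivity, ?_⟩
  intro N k hN hk hk₀ v v' Y Y' hsm hsm' hvβ hvβ' hY hY'
  have hkb : ∀ j, |k * b j| ≤ k * B := fun j => by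
    rw [abs_mul, abs_of_pos hk]; gcongr; exact hbB j
  have hkBL : 4 * (k * B) * L ≤ 1 := by
    rw [le_div_iff₀ (by positivity)] at hk₀
    refine le_trans ?_ hk₀
    calc 4 * (k * B) * L = k * (4 * B * L) := by ring
      _ ≤ _ := by gcongr <;> linarith
  have hc1 : ∀ j, 4 * |k * b j| * K * ρ ^ 2 ≤ 1 := fun j => by
    refine le_trans ?_ hkBL
    rw [mul_assoc]
    gcongr
    exact hkb j
  have hc2 : ∀ j, |k * b j| * L ≤ 1 := fun j => by
    have := mul_le_mul_of_nonneg_right (hkb j) hL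
    nlinarith [mul_nonneg (abs_nonneg (k * b j)) hL]
  have hbound : ∀ (v : C(Circ, ℂ)) (Y : Fin (q + 1) → C(Circ, ℂ)),
      (∀ j, N * |k * b j| * hNorm 0 v ^ 2 ≤ 1 / 18) → hNorm s v ≤ β → IsStages s N k b v Y →
      ∀ j, hNorm s (Y j) ≤ ρ := by
    intro v Y hsm hvβ hY
    obtain ⟨Z, hZ, hZb⟩ := exists_stages hN (hY.start ▸ hY.mem 0) hsm hK.le hcub
    rw [hY.unique hN hsm hZ]
    exact hZb β hβ hvβ hc1
  have b1 := hbound v Y hsm hvβ hY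
  have b2 := hbound v' Y' hsm' hvβ' hY'
  have key : ∀ j : Fin (q + 1), hNorm s (Y j - Y' j)
      ≤ Real.exp ((j : ℕ) * (2 * L * (k * B))) * hNorm s (v - v') := by
    intro j
    induction j using Fin.induction with
    | zero => simp [hY.start, hY'.start]
    | succ j ih =>
      have st := IsStep.stability (hY.mem _) (hY'.mem _) (hY.mem _) (hY'.mem _) (hY.isStep j)
        (hY'.isStep j) hL (hc2 j) (hlip ρ) (b1 _) (b2 _) (b1 _) (b2 _)
      refine st.trans ?_
      calc Real.exp (2 * L * |k * b j|) * hNorm s (Y j.castSucc - Y' j.castSucc)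
          ≤ Real.exp (2 * L * (k * B))
            * (Real.exp ((j : ℕ) * (2 * L * (k * B))) * hNorm s (v - v')) := by
            gcongr
            · exact hNorm_nonneg _ _
            · exact hkb j
            · exact ih
        _ = _ := by
            rw [← mul_assoc, ← Real.exp_add, Fin.val_succ]
            congr 2
            push_cast; ring
  have := key (Fin.last q)
  rw [Fin.val_last] at this
  refine this.trans (le_of_eq ?_)
  congr 2; ring

section Scheme

variable {s : ℝ} {N M : ℕ} {k : ℝ} {q : ℕ} {b : Fin q → ℝ} {u₀ : C(Circ, ℂ)}

lemma IsFullyDiscrete.mem {U : Fin (M + 1) → C(Circ, ℂ)} {Y : Fin M → Fin (q + 1) → C(Circ, ℂ)}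
    (h : IsFullyDiscrete s N M k b u₀ U Y) (n : Fin (M + 1)) : U n ∈ trigPoly N := by
  refine Fin.cases ?_ (fun i => ?_) n
  · rw [h.initial]; exact proj_mem N u₀
  · rw [h.update]; exact (h.stages i).mem _

lemma IsFullyDiscrete.hNorm_zero_eq {U : Fin (M + 1) → C(Circ, ℂ)}
    {Y : Fin M → Fin (q + 1) → C(Circ, ℂ)} (h : IsFullyDiscrete s N M k b u₀ U Y)
    (n : Fin (M + 1)) : hNorm 0 (U n) = hNorm 0 (proj N u₀) := by
  induction n using Fin.induction with
  | zero => rw [h.initial]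
  | succ i ih => rw [h.update, (h.stages i).hNorm_zero_eq, ih]

/-- The fully discrete scheme is uniquely solvable under the smallness condition. -/
lemma existsUnique_fullyDiscrete (hs : 1 / 2 < s) (hs1 : s ≤ 1) (hN : 1 ≤ N)
    (hsmall : ∀ j, N * |k * b j| * hNorm 0 (proj N u₀) ^ 2 ≤ 1 / 18) :
    ∃! P : (Fin (M + 1) → C(Circ, ℂ)) × (Fin M → Fin (q + 1) → C(Circ, ℂ)),
      IsFullyDiscrete s N M k b u₀ P.1 P.2 := by
  obtain ⟨K, hK, hcub, -⟩ := exists_cubic_const hs hs1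
  obtain ⟨U, h0, h1, h2⟩ := exists_chain
    (fun (_ : Fin M) (x y : C(Circ, ℂ)) =>
      ∃ Y : Fin (q + 1) → C(Circ, ℂ), IsStages s N k b x Y ∧ y = Y (Fin.last q))
    (fun x => x ∈ trigPoly N ∧ hNorm 0 x = hNorm 0 (proj N u₀))
    (fun _ x hx => by
      obtain ⟨Y, hY, -⟩ := exists_stages (b := b) (k := k) hN hx.1
        (by rw [hx.2]; exact hsmall) hK.le hcub
      exact ⟨_, ⟨hY.mem _, (hY.hNorm_zero_eq _).trans hx.2⟩, Y, hY, rfl⟩)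
    (proj N u₀) ⟨proj_mem N u₀, rfl⟩
  choose Y hY hU using h2
  refine ⟨(U, Y), ⟨h0, hY, hU⟩, fun P hP => ?_⟩
  have hF : IsFullyDiscrete s N M k b u₀ U Y := ⟨h0, hY, hU⟩
  have uniq : ∀ n : Fin M, P.1 n.castSucc = U n.castSucc → P.2 n = Y n := fun n hn => by
    have := hP.stages n
    rw [hn] at this
    exact this.unique hN (by rw [hF.hNorm_zero_eq]; exact hsmall) (hY n)
  have hPU : ∀ n, P.1 n = U n := by
    intro n
    induction n using Fin.induction with
    | zero => rw [hP.initial, h0]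
    | succ n ih => rw [hP.update, hU, uniq n ih]
  exact Prod.ext (funext hPU) (funext fun n => uniq n (hPU _))

end Scheme

/-! ### The semidiscrete approximation -/

/-- The Fourier modes of the semidiscrete approximation satisfy the expected system of ordinary
differential equations. -/
lemma IsSemidiscrete.coef_hasDeriv {s T : ℝ} {N : ℕ} {u₀ : C(Circ, ℂ)} {uN : ℝ → C(Circ, ℂ)}
    (h : IsSemidiscrete s T N u₀ uN) {t : ℝ} (ht : t ∈ Set.Icc 0 T) (m : ℤ) :
    HasDerivWithinAt (fun τ => fourierCoeff (uN τ) m) (fourierCoeff (field s N (uN t)) m)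
      (Set.Icc 0 T) t :=
  ((coefL m).restrictScalars ℝ).hasFDerivAt.comp_hasDerivWithinAt t (h.equation t ht)

/-- The semidiscrete approximation conserves the `L²` norm. -/
lemma IsSemidiscrete.hNorm_zero_eq {s T : ℝ} (hT : 0 < T) {N : ℕ} {u₀ : C(Circ, ℂ)}
    {uN : ℝ → C(Circ, ℂ)} (h : IsSemidiscrete s T N u₀ uN) {t : ℝ} (ht : t ∈ Set.Icc 0 T) :
    hNorm 0 (uN t) = hNorm 0 (proj N u₀) := by
  set E : ℝ → ℝ := fun τ => ∑ m ∈ Finset.Icc (-(N : ℤ)) N, ‖fourierCoeff (uN τ) m‖ ^ 2 with hE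
  have hEN : ∀ τ ∈ Set.Icc 0 T, hNorm 0 (uN τ) ^ 2 = E τ := fun τ hτ => by
    rw [hNorm_sq_of_mem 0 (h.mem τ hτ)]; simp [hE]
  have hd : ∀ τ ∈ Set.Icc 0 T, HasDerivWithinAt E 0 (Set.Icc 0 T) τ := fun τ hτ => by
    have h1 := HasDerivWithinAt.fun_sum (u := Finset.Icc (-(N : ℤ)) N)
      fun m _ => (h.coef_hasDeriv hτ m).norm_sq
    refine h1.congr_deriv ?_
    simp only [Complex.inner]
    rw [← Finset.mul_sum]
    have h2 := re_pairing_field s (h.mem τ hτ)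
    rw [Complex.re_sum] at h2
    have h3 : ∀ m, (fourierCoeff (field s N (uN τ)) m * conj (fourierCoeff (uN τ) m)).re
        = (conj (fourierCoeff (uN τ) m) * fourierCoeff (field s N (uN τ)) m).re :=
      fun m => by rw [mul_comm]
    simp only [h3, h2, mul_zero]
  have hc := constant_of_derivWithin_zero (fun τ hτ => (hd τ hτ).differentiableWithinAt)
    (fun τ hτ => (hd τ (Set.Ico_subset_Icc_self hτ)).derivWithin
      (uniqueDiffOn_Icc hT τ (Set.Ico_subset_Icc_self hτ))) t ht
  have h0 : (0 : ℝ) ∈ Set.Icc 0 T := ⟨le_rfl, hT.le⟩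
  rw [← hEN t ht, ← hEN 0 h0, h.initial] at hc
  exact (pow_left_inj₀ (hNorm_nonneg _ _) (hNorm_nonneg _ _) two_ne_zero).mp hc

lemma hNorm_proj_le {r : ℝ} (N : ℕ) {v : C(Circ, ℂ)} (hv : MemH r v) :
    hNorm r (proj N v) ≤ hNorm r v := by
  refine (hNorm_mono hv fun m => ?_).2
  rw [coef_proj]
  split_ifs <;> simp

/-- The modes `|m| > N` of `x`, if they agree in modulus with those of some `v` in `H^μ`, contribute
at most `N^{s-μ} ‖v‖_μ` to the `H^s` norm of `x`. -/
lemma hNorm_sq_le_add_tail {s μ : ℝ} (hμ : s < μ) {N : ℕ} (hN : 1 ≤ N) {x v : C(Circ, ℂ)}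
    (hx : MemH s x) (hv : MemH μ v)
    (h : ∀ m ∉ Finset.Icc (-(N : ℤ)) N, ‖fourierCoeff x m‖ = ‖fourierCoeff v m‖) :
    hNorm s x ^ 2
      ≤ (∑ m ∈ Finset.Icc (-(N : ℤ)) N, (1 + (m : ℝ) ^ 2) ^ s * ‖fourierCoeff x m‖ ^ 2)
        + ((N : ℝ) ^ (s - μ) * hNorm μ v) ^ 2 := by
  have hN0 : (0 : ℝ) < N := by exact_mod_cast hN
  set S := Finset.Icc (-(N : ℤ)) N
  set a : ℤ → ℝ := fun m => (1 + (m : ℝ) ^ 2) ^ s * ‖fourierCoeff x m‖ ^ 2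
  have h1 : HasSum (fun m => if m ∈ S then a m else 0) (∑ m ∈ S, a m) := by
    have : HasSum (fun m => if m ∈ S then a m else 0) (∑ m ∈ S, if m ∈ S then a m else 0) :=
      hasSum_sum_of_ne_finset_zero fun m hm => if_neg hm
    convert this using 1
    exact Finset.sum_congr rfl fun m hm => (if_pos hm).symm
  have h2 := hv.hasSum.mul_left (((N : ℝ) ^ (s - μ)) ^ 2)
  rw [← hNorm_sq, ← mul_pow] at h2
  rw [hNorm_sq]
  refine hasSum_le (fun m => ?_) hx.hasSum (h1.add h2)
  have hnn : 0 ≤ ((N : ℝ) ^ (s - μ)) ^ 2 * ((1 + (m : ℝ) ^ 2) ^ μ * ‖fourierCoeff v m‖ ^ 2) :=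
    mul_nonneg (by positivity) (mul_nonneg (wt_pos _ _).le (by positivity))
  by_cases hm : m ∈ S
  · simp only [if_pos hm]
    exact le_add_of_nonneg_right hnn
  · simp only [if_neg hm, zero_add]
    rw [h m hm, ← mul_assoc]
    gcongr ?_ * _
    have hm' : (N : ℝ) ^ 2 ≤ 1 + (m : ℝ) ^ 2 := by
      have h3 : (N : ℤ) < |m| := by
        by_contra hcon
        exact hm (Finset.mem_Icc.mpr (abs_le.mp (not_lt.mp hcon)))
      have h4 : (N : ℝ) ≤ |(m : ℝ)| := by exact_mod_cast h3.le
      have h5 := pow_le_pow_left₀ hN0.le h4 2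
      rw [sq_abs] at h5
      linarith
    have h6 : (1 + (m : ℝ) ^ 2) ^ (s - μ) ≤ ((N : ℝ) ^ (s - μ)) ^ 2 := by
      have h7 : ((N : ℝ) ^ (s - μ)) ^ 2 = ((N : ℝ) ^ 2) ^ (s - μ) := by
        rw [← Real.rpow_natCast, ← Real.rpow_mul hN0.le, mul_comm, Real.rpow_mul hN0.le,
          Real.rpow_natCast]
      rw [h7]
      exact Real.rpow_le_rpow_of_nonpos (by positivity) hm' (by linarith)
    calc (1 + (m : ℝ) ^ 2) ^ s = (1 + (m : ℝ) ^ 2) ^ (s - μ) * (1 + (m : ℝ) ^ 2) ^ μ := by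
          rw [← Real.rpow_add (by positivity), sub_add_cancel]
      _ ≤ _ := by
          have := (wt_pos μ m).le
          gcongr

/-- The energy estimate for a single Fourier mode `e` of the error: the dispersive term is
orthogonal to `e` and drops out. -/
lemma two_mul_inner_le (l : ℝ) (e g : ℂ) :
    2 * inner ℝ e (-(Complex.I * ((l : ℂ) * e)) + Complex.I * g) ≤ ‖e‖ ^ 2 + ‖g‖ ^ 2 := by
  have h1 : inner ℝ e (-(Complex.I * ((l : ℂ) * e))) = (0 : ℝ) := by
    rw [Complex.inner]
    simp
    ring
  rw [inner_add_right, h1, zero_add]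
  have h2 := real_inner_le_norm e (Complex.I * g)
  rw [norm_mul, Complex.norm_I, one_mul] at h2
  nlinarith [sq_nonneg (‖e‖ - ‖g‖)]

/-- The `H^s` error of the semidiscrete approximation, with `δ` a bound of the truncation error.
If the barrier `2 δ² e^{ct}` stays below `1`, then a continuity argument closes the energy
estimate, which needs the Lipschitz constant `L` of the nonlinearity only near the exact
solution. -/
lemma IsSemidiscrete.error_sq_le {s T μ : ℝ} (hT : 0 < T) (hμ : s < μ) {N : ℕ} (hN : 1 ≤ N)
    {u₀ : C(Circ, ℂ)} {u uN : ℝ → C(Circ, ℂ)} (hu : IsSolution s T u₀ u)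
    (h : IsSemidiscrete s T N u₀ uN) {B L δ : ℝ}
    (huB : ∀ t ∈ Set.Icc (0 : ℝ) T, MemH μ (u t) ∧ hNorm μ (u t) ≤ B)
    (hlip : ∀ w w' : C(Circ, ℂ), MemH s w → MemH s w' → hNorm s w ≤ B + 2 → hNorm s w' ≤ B + 2 →
        MemH s (cubic w - cubic w') ∧ hNorm s (cubic w - cubic w') ≤ L * hNorm s (w - w'))
    (hδ : 0 < δ) (hδN : (N : ℝ) ^ (s - μ) * B ≤ δ)
    (hsmall : 2 * δ ^ 2 * Real.exp (2 * (1 + L ^ 2) * T) ≤ 1) {t : ℝ} (ht : t ∈ Set.Icc 0 T) :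
    hNorm s (uN t - u t) ^ 2 ≤ 3 * Real.exp (2 * (1 + L ^ 2) * T) * δ ^ 2 := by
  set c : ℝ := 2 * (1 + L ^ 2) with hc
  have hc0 : 0 < c := by positivity
  set S := Finset.Icc (-(N : ℤ)) N with hS
  set E : ℝ → ℝ := fun τ =>
    ∑ m ∈ S, (1 + (m : ℝ) ^ 2) ^ s * ‖fourierCoeff (uN τ) m - fourierCoeff (u τ) m‖ ^ 2 with hE
  -- the error is controlled by the energy of its low modes
  have hEδ : ∀ τ ∈ Set.Icc 0 T, hNorm s (uN τ - u τ) ^ 2 ≤ E τ + δ ^ 2 := fun τ hτ => by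
    have hm := memH_of_mem s (h.mem τ hτ)
    have := hNorm_sq_le_add_tail hμ hN (hm.sub ((huB τ hτ).1.mono hμ.le).1).1 (huB τ hτ).1
      (fun m hmS => by rw [coef_sub, coef_of_mem (h.mem τ hτ) hmS, zero_sub, norm_neg])
    simp only [coef_sub] at this
    refine this.trans (add_le_add le_rfl (pow_le_pow_left₀ ?_ ?_ 2))
    · exact mul_nonneg (by positivity) (hNorm_nonneg _ _)
    · refine le_trans ?_ hδN
      gcongr
      exact (huB τ hτ).2
  set R : ℝ → ℤ → ℂ := fun τ m =>
    -(Complex.I * (((|(m : ℝ)| ^ (2 * s) : ℝ) : ℂ)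
        * (fourierCoeff (uN τ) m - fourierCoeff (u τ) m)))
      + Complex.I * fourierCoeff (⇑(cubic (uN τ) - cubic (u τ))) m with hR
  set E' : ℝ → ℝ := fun τ => ∑ m ∈ S, (1 + (m : ℝ) ^ 2) ^ s *
    (2 * inner ℝ (fourierCoeff (uN τ) m - fourierCoeff (u τ) m) (R τ m)) with hE'
  have hd : ∀ τ ∈ Set.Icc 0 T, HasDerivWithinAt E (E' τ) (Set.Icc 0 T) τ := fun τ hτ => by
    refine HasDerivWithinAt.fun_sum fun m hm => ?_
    have h1 := (h.coef_hasDeriv hτ m).sub (hu.equation τ hτ m)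
    rw [coef_field, if_pos hm] at h1
    have h2 : HasDerivWithinAt (fun τ => fourierCoeff (uN τ) m - fourierCoeff (u τ) m) (R τ m)
        (Set.Icc 0 T) τ := by
      refine h1.congr_deriv ?_
      simp only [hR, coef_sub]
      ring
    exact h2.norm_sq.const_mul _
  have hT0 : (0 : ℝ) ∈ Set.Icc 0 T := ⟨le_rfl, hT.le⟩
  have hbar := image_le_of_deriv_right_lt_deriv_boundary' (f := E) (f' := E') (a := 0) (b := T)
    (B := fun τ => 2 * δ ^ 2 * Real.exp (c * τ))
    (B' := fun τ => c * (2 * δ ^ 2 * Real.exp (c * τ)))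
    (fun τ hτ => (hd τ hτ).continuousWithinAt)
    (fun τ hτ => by
      refine (hd τ (Set.Ico_subset_Icc_self hτ)).mono_of_mem_nhdsWithin ?_
      exact mem_of_superset (Icc_mem_nhdsGE hτ.2) (Set.Icc_subset_Icc_left hτ.1))
    (by
      have : E 0 = 0 := Finset.sum_eq_zero fun m hm => by
        rw [h.initial, hu.initial, coef_proj, if_pos hm, sub_self]; simp
      rw [this]; positivity)
    (by fun_prop)
    (fun τ _ => by
      have h1 : HasDerivAt (fun τ => 2 * δ ^ 2 * Real.exp (c * τ))
          (2 * δ ^ 2 * (Real.exp (c * τ) * c)) τ :=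
        (((hasDerivAt_id τ).const_mul c).congr_deriv (mul_one c)).exp.const_mul _
      exact (h1.congr_deriv (by ring)).hasDerivWithinAt)
    (fun τ hτ' heq => by
      have hτ := Set.Ico_subset_Icc_self hτ'
      have hexp1 : 1 ≤ Real.exp (c * τ) := Real.one_le_exp (mul_nonneg hc0.le hτ.1)
      have hexp2 : Real.exp (c * τ) ≤ Real.exp (c * T) :=
        Real.exp_le_exp.mpr (mul_le_mul_of_nonneg_left hτ.2 hc0.le)
      have hδ2 : 0 < δ ^ 2 := by positivity
      have hlow : 2 * δ ^ 2 ≤ E τ := by rw [heq]; nlinarith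
      have hup : E τ ≤ 1 := by rw [heq]; nlinarith
      have hs2 := hEδ τ hτ
      have hmN := memH_of_mem s (h.mem τ hτ)
      have hmu := (huB τ hτ).1.mono hμ.le
      have herr : hNorm s (uN τ - u τ) ≤ 2 := by nlinarith [hNorm_nonneg s (uN τ - u τ)]
      have hub : hNorm s (u τ) ≤ B := hmu.2.trans (huB τ hτ).2
      have huNb : hNorm s (uN τ) ≤ B + 2 := by
        have := ((hmN.sub hmu.1).1.add hmu.1).2
        rw [sub_add_cancel] at this
        linarith
      obtain ⟨g1, g2⟩ := hlip _ _ hmN hmu.1 huNb (by linarith)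
      have g3 : hNorm s (cubic (uN τ) - cubic (u τ)) ^ 2 ≤ L ^ 2 * (E τ + δ ^ 2) := by
        calc _ ≤ (L * hNorm s (uN τ - u τ)) ^ 2 := pow_le_pow_left₀ (hNorm_nonneg _ _) g2 2
          _ = L ^ 2 * hNorm s (uN τ - u τ) ^ 2 := by ring
          _ ≤ _ := by gcongr
      have g4 : E' τ ≤ E τ + hNorm s (cubic (uN τ) - cubic (u τ)) ^ 2 := by
        refine le_trans ?_ (add_le_add le_rfl (sum_le_hNorm_sq g1 S))
        rw [← Finset.sum_add_distrib]
        refine Finset.sum_le_sum fun m _ => ?_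
        rw [← mul_add]
        exact mul_le_mul_of_nonneg_left (two_mul_inner_le _ _ _) (wt_pos s m).le
      rw [← heq]
      nlinarith [sq_nonneg L])
  have h1 : E t ≤ 2 * δ ^ 2 * Real.exp (c * t) := hbar ht
  have h2 := hEδ t ht
  have hexp2 : Real.exp (c * t) ≤ Real.exp (c * T) :=
    Real.exp_le_exp.mpr (mul_le_mul_of_nonneg_left ht.2 hc0.le)
  have hexp3 : 1 ≤ Real.exp (c * T) := Real.one_le_exp (by positivity)
  have hδ2 : 0 < δ ^ 2 := by positivity
  nlinarith

/-- Spectral accuracy of the semidiscrete approximation in `H^s`. -/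
lemma exists_semidiscrete_const {s T μ : ℝ} (hs : 1 / 2 < s) (hs1 : s ≤ 1) (hT : 0 < T)
    (hμ : s < μ) {u₀ : C(Circ, ℂ)} {u : ℝ → C(Circ, ℂ)} (hu : IsSolution s T u₀ u) {B : ℝ}
    (huB : ∀ t ∈ Set.Icc (0 : ℝ) T, MemH μ (u t) ∧ hNorm μ (u t) ≤ B) :
    ∃ C : ℝ, 0 ≤ C ∧ ∀ (N : ℕ) (uN : ℝ → C(Circ, ℂ)), 1 ≤ N → IsSemidiscrete s T N u₀ uN →
      ∀ t ∈ Set.Icc (0 : ℝ) T, hNorm s (uN t - u t) ≤ C * (N : ℝ) ^ (s - μ) := by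
  obtain ⟨K, hK, -, hlip⟩ := exists_cubic_const hs hs1
  have hB0 : 0 ≤ B := (hNorm_nonneg _ _).trans (huB 0 ⟨le_rfl, hT.le⟩).2
  set L : ℝ := K * (B + 2) ^ 2
  have hL : 0 ≤ L := by positivity
  set X : ℝ := Real.exp (2 * (1 + L ^ 2) * T)
  have hX : 0 < X := Real.exp_pos _
  have hlim : Tendsto (fun N : ℕ => 2 * ((B + 1) * (N : ℝ) ^ (s - μ)) ^ 2 * X) atTop
      (𝓝 (2 * ((B + 1) * 0) ^ 2 * X)) := by
    have h1 := (tendsto_rpow_neg_atTop (y := μ - s) (by linarith)).comp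
      tendsto_natCast_atTop_atTop
    have h2 : Tendsto (fun N : ℕ => (N : ℝ) ^ (s - μ)) atTop (𝓝 0) := by
      refine h1.congr fun N => ?_
      simp only [Function.comp_apply]
      congr 1; ring
    exact (((h2.const_mul _).pow 2).const_mul 2).mul_const X
  have hev := hlim.eventually_le_const (u := 1) (by norm_num)
  obtain ⟨N₀, hN₀⟩ := eventually_atTop.mp hev
  set A : ℝ := (1 + N₀) * hNorm 0 u₀ + B
  have hA : 0 ≤ A := by
    have := hNorm_nonneg 0 u₀
    positivity
  have hN₁ : (0 : ℝ) < N₀ + 1 := by positivity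
  refine ⟨Real.sqrt (3 * X) * (B + 1) + A / ((N₀ : ℝ) + 1) ^ (s - μ), by positivity,
    fun N uN hN h t ht => ?_⟩
  have hNpos : (0 : ℝ) < N := by exact_mod_cast hN
  have hP : 0 < (N : ℝ) ^ (s - μ) := Real.rpow_pos_of_pos hNpos _
  have hQ : 0 < ((N₀ : ℝ) + 1) ^ (s - μ) := Real.rpow_pos_of_pos hN₁ _
  rw [add_mul]
  by_cases hcase : N₀ ≤ N
  · have h1 := h.error_sq_le hT hμ hN hu huB (hlip (B + 2)) (δ := (B + 1) * (N : ℝ) ^ (s - μ))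
      (by positivity) (by nlinarith) (hN₀ N hcase) ht
    have h2 : hNorm s (uN t - u t) ≤ Real.sqrt (3 * X) * (B + 1) * (N : ℝ) ^ (s - μ) := by
      apply le_of_sq_le_sq _ (by positivity)
      refine h1.trans (le_of_eq ?_)
      rw [mul_assoc (Real.sqrt _), mul_pow (Real.sqrt _), Real.sq_sqrt (by positivity)]
    have h3 : 0 ≤ A / ((N₀ : ℝ) + 1) ^ (s - μ) * (N : ℝ) ^ (s - μ) := by positivity
    linarith
  · -- for the finitely many small `N` the conserved `L²` norm controls everything
    have hmN := memH_of_mem s (h.mem t ht)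
    have hmu := (huB t ht).1.mono hμ.le
    have hNN : (N : ℝ) ≤ N₀ := by exact_mod_cast (not_le.mp hcase).le
    have h1 : hNorm s (uN t) ≤ (1 + N₀) * hNorm 0 u₀ := by
      refine (hNorm_le_of_mem hs1 (h.mem t ht)).trans ?_
      rw [h.hNorm_zero_eq hT ht]
      have := hNorm_proj_le N (memH_zero u₀)
      have h0 := hNorm_nonneg 0 (proj N u₀)
      gcongr
    have h2 : hNorm s (uN t - u t) ≤ A := (hmN.sub hmu.1).2.trans
      (add_le_add h1 (hmu.2.trans (huB t ht).2))
    have h3 : ((N₀ : ℝ) + 1) ^ (s - μ) ≤ (N : ℝ) ^ (s - μ) :=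
      Real.rpow_le_rpow_of_nonpos hNpos (by linarith) (by linarith)
    have h4 : A ≤ A / ((N₀ : ℝ) + 1) ^ (s - μ) * (N : ℝ) ^ (s - μ) := by
      rw [div_mul_eq_mul_div, le_div_iff₀ hQ]
      gcongr
    have h5 : 0 ≤ Real.sqrt (3 * X) * (B + 1) * (N : ℝ) ^ (s - μ) := by positivity
    linarith

/-! ### The error of the fully discrete scheme -/

/-- The smallness condition in terms of the normalized `L²` norm `x`; the constant is `1/18`
since `3 * 2π > 18`. -/
lemma small_of_cond {R k b x : ℝ} {N : ℕ} (hk : 0 < k) (hR : R ^ 2 = 2 * Real.pi * x ^ 2)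
    (h : 3 * R ^ 2 * k * (N : ℝ) * |b| < 1) : N * |k * b| * x ^ 2 ≤ 1 / 18 := by
  rw [hR] at h
  rw [abs_mul, abs_of_pos hk]
  have hp := Real.pi_gt_three
  have h0 : 0 ≤ N * (k * |b|) * x ^ 2 := by positivity
  nlinarith

/-- For step sizes bounded from below, the smallness condition bounds `N` unless the initial value
vanishes; in either case all elements of `S_N` on the `L²` sphere of the initial value
are bounded in `H^s`. -/
lemma exists_large_step_bound {s : ℝ} (hs1 : s ≤ 1) (u₀ : C(Circ, ℂ)) {b k₁ : ℝ} (hb : b ≠ 0)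
    (hk₁ : 0 < k₁) :
    ∃ D : ℝ, 0 ≤ D ∧ ∀ (N : ℕ) (k : ℝ) (w : C(Circ, ℂ)), k₁ ≤ k →
      N * |k * b| * hNorm 0 (proj N u₀) ^ 2 ≤ 1 / 18 → w ∈ trigPoly N →
      hNorm 0 w = hNorm 0 (proj N u₀) → hNorm s w ≤ D := by
  by_cases hu : ∀ m, fourierCoeff u₀ m = 0
  · refine ⟨0, le_rfl, fun N k w _ _ hw hwn => ?_⟩
    have h0 : proj N u₀ = 0 := by simp only [proj, hu, zero_smul, Finset.sum_const_zero]
    rw [eq_zero_of_hNorm hw (by rw [hwn, h0, hNorm_of_zero]), hNorm_of_zero]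
  · push Not at hu
    obtain ⟨m, hm⟩ := hu
    have ha : 0 < ‖fourierCoeff u₀ m‖ ^ 2 := by positivity
    set a := ‖fourierCoeff u₀ m‖ ^ 2
    have hb' : 0 < |b| := abs_pos.mpr hb
    have hn0 := hNorm_nonneg 0 u₀
    refine ⟨(1 + (|(m : ℝ)| + 1 / (18 * k₁ * |b| * a))) * hNorm 0 u₀, by positivity,
      fun N k w hk hsm hw hwn => ?_⟩
    have hk0 : 0 < k := hk₁.trans_le hk
    have hN : (N : ℝ) ≤ |(m : ℝ)| + 1 / (18 * k₁ * |b| * a) := by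
      by_cases hmN : m ∈ Finset.Icc (-(N : ℤ)) N
      · have h1 := sum_le_hNorm_sq (memH_zero (proj N u₀)) {m}
        rw [Finset.sum_singleton, Real.rpow_zero, one_mul, coef_proj, if_pos hmN] at h1
        have h2 : N * (k₁ * |b|) * a ≤ 1 / 18 := by
          refine le_trans ?_ hsm
          rw [abs_mul, abs_of_pos hk0]
          gcongr
        have h3 : (N : ℝ) ≤ 1 / (18 * k₁ * |b| * a) := by
          rw [le_div_iff₀ (by positivity)]
          linarith
        linarith [abs_nonneg (m : ℝ)]
      · have h1 : (N : ℤ) < |m| := by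
          by_contra hcon
          exact hmN (Finset.mem_Icc.mpr (abs_le.mp (not_lt.mp hcon)))
        have h2 : (N : ℝ) ≤ |(m : ℝ)| := by exact_mod_cast h1.le
        have h3 : 0 ≤ 1 / (18 * k₁ * |b| * a) := by positivity
        linarith
    refine (hNorm_le_of_mem hs1 hw).trans ?_
    have h0 := hNorm_nonneg 0 w
    have h1 : hNorm 0 w ≤ hNorm 0 u₀ := hwn.trans_le (hNorm_proj_le N (memH_zero u₀))
    gcongr

/-- The temporal error for short steps. The local errors add up by the `H^s` stability of
the scheme, and smallness of the step keeps the discrete solution in the ball of radius `β`, where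
the stability constant `c` is valid. -/
lemma temporal_error_le {s T : ℝ} (hs : 1 / 2 < s) (hs1 : s ≤ 1) (hT : 0 < T) {q : ℕ}
    {b : Fin q → ℝ} {u₀ : C(Circ, ℂ)} {N M : ℕ} (hN : 1 ≤ N) {k : ℝ} (hk : 0 < k)
    (hMk : (M : ℝ) * k = T) {uN : ℝ → C(Circ, ℂ)} (huN : IsSemidiscrete s T N u₀ uN)
    (hsmall : ∀ j, N * |k * b j| * hNorm 0 (proj N u₀) ^ 2 ≤ 1 / 18) {c β ε : ℝ} (hc : 0 ≤ c)
    (hβ : ∀ t ∈ Set.Icc (0 : ℝ) T, hNorm s (uN t) + 1 ≤ β)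
    (hstab : ∀ (v v' : C(Circ, ℂ)) (Y Y' : Fin (q + 1) → C(Circ, ℂ)),
        (∀ j, N * |k * b j| * hNorm 0 v ^ 2 ≤ 1 / 18) →
        (∀ j, N * |k * b j| * hNorm 0 v' ^ 2 ≤ 1 / 18) →
        hNorm s v ≤ β → hNorm s v' ≤ β → IsStages s N k b v Y → IsStages s N k b v' Y' →
        hNorm s (Y (Fin.last q) - Y' (Fin.last q)) ≤ Real.exp (c * k) * hNorm s (v - v'))
    (hε : 0 ≤ ε) (hε1 : Real.exp (c * T) * (M * ε) ≤ 1)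
    (hloc : ∀ n : ℕ, n < M → ∀ Z : Fin (q + 1) → C(Circ, ℂ),
        IsStages s N k b (uN ((n : ℝ) * k)) Z →
        hNorm s (uN (((n : ℝ) + 1) * k) - Z (Fin.last q)) ≤ ε)
    {U : Fin (M + 1) → C(Circ, ℂ)} {Y : Fin M → Fin (q + 1) → C(Circ, ℂ)}
    (hUY : IsFullyDiscrete s N M k b u₀ U Y) (n : Fin (M + 1)) :
    hNorm s (U n - uN (((n : ℕ) : ℝ) * k)) ≤ Real.exp (c * T) * (M * ε) := by
  obtain ⟨K, hK, hcub, -⟩ := exists_cubic_const hs hs1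
  have htime : ∀ n : ℕ, n ≤ M → (n : ℝ) * k ∈ Set.Icc (0 : ℝ) T := fun n hn => by
    refine ⟨by positivity, ?_⟩
    rw [← hMk]
    gcongr
  have hgrow : ∀ n : ℕ, n ≤ M →
      Real.exp (c * (n * k)) * (n * ε) ≤ Real.exp (c * T) * (M * ε) := fun n hn => by
    have := (htime n hn).2
    gcongr
  have key : ∀ n : Fin (M + 1), hNorm s (U n - uN (((n : ℕ) : ℝ) * k))
      ≤ Real.exp (c * ((n : ℕ) * k)) * ((n : ℕ) * ε) := by
    intro n
    induction n using Fin.induction with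
    | zero =>
      simp [hUY.initial, huN.initial]
    | succ n ih =>
      rw [Fin.val_castSucc] at ih
      have ht := htime n n.2.le
      have hm := huN.mem _ ht
      have hUm := hUY.mem n.castSucc
      have hsm' : ∀ j, N * |k * b j| * hNorm 0 (uN ((n : ℕ) * k)) ^ 2 ≤ 1 / 18 := by
        rw [huN.hNorm_zero_eq hT ht]; exact hsmall
      obtain ⟨Z, hZ, -⟩ := exists_stages hN hm hsm' hK.le hcub
      have hUβ : hNorm s (U n.castSucc) ≤ β := by
        have h1 := ((memH_of_mem s (Submodule.sub_mem _ hUm hm)).add (memH_of_mem s hm)).2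
        rw [sub_add_cancel] at h1
        linarith [hβ _ ht, hgrow n n.2.le]
      have h1 := hstab _ _ _ _ (by rw [hUY.hNorm_zero_eq]; exact hsmall) hsm' hUβ
        (by linarith [hβ _ ht]) (hUY.stages n) hZ
      have h2 := hloc n n.2 Z hZ
      have ht' := htime (n + 1) n.2
      push_cast at ht'
      have h3 := ((memH_of_mem s (Submodule.sub_mem _ ((hUY.stages n).mem (Fin.last q))
        (hZ.mem (Fin.last q)))).sub
        (memH_of_mem s (Submodule.sub_mem _ (huN.mem _ ht') (hZ.mem (Fin.last q))))).2
      rw [sub_sub_sub_cancel_right, ← hUY.update n] at h3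
      rw [Fin.val_succ]
      push_cast
      have h4 : Real.exp (c * k) * hNorm s (U n.castSucc - uN ((n : ℕ) * k))
          ≤ Real.exp (c * k) * (Real.exp (c * ((n : ℕ) * k)) * ((n : ℕ) * ε)) := by gcongr
      have h5 : Real.exp (c * k) * (Real.exp (c * ((n : ℕ) * k)) * ((n : ℕ) * ε))
          = Real.exp (c * (((n : ℕ) + 1) * k)) * ((n : ℕ) * ε) := by
        rw [← mul_assoc, ← Real.exp_add]; congr 2; ring
      have h6 : ε ≤ Real.exp (c * (((n : ℕ) + 1) * k)) * ε :=
        le_mul_of_one_le_left hε (Real.one_le_exp (by positivity))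
      rw [← hUY.update n] at h1
      linarith
  exact (key n).trans (hgrow n (Nat.lt_succ_iff.mp n.2))

end FNLS

end

theorem theorem3p4
    (s : ℝ) (hs : 1 / 2 < s) (hs1 : s ≤ 1) (T : ℝ) (hT : 0 < T)
    (q : ℕ) (hq : 1 ≤ q) (b : Fin q → ℝ) (hb : ∀ j, b j ≠ 0)
    (μ : ℝ) (hμ : s < μ)
    (u₀ : C(FNLS.Circ, ℂ)) (u : ℝ → C(FNLS.Circ, ℂ)) (hu : FNLS.IsSolution s T u₀ u)
    (huμ : ∃ B : ℝ, ∀ t ∈ Set.Icc (0 : ℝ) T, FNLS.MemH μ (u t) ∧ FNLS.hNorm μ (u t) ≤ B)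
    (α : ℕ) (hα : 1 < α) (CΘ : ℝ) :
    ∃ C : ℝ, ∀ (N M : ℕ) (k : ℝ) (uN : ℝ → C(FNLS.Circ, ℂ)),
      1 ≤ N → 0 < k → (M : ℝ) * k = T →
      FNLS.IsSemidiscrete s T N u₀ uN →
      -- the smallness condition on the step size, with `R = ‖U⁰‖`
      (∀ j, 3 * FNLS.l2Norm (FNLS.proj N u₀) ^ 2 * k * (N : ℝ) * |b j| < 1) →
      -- the bound for the local temporal errors in the norm of `H^s`
      (∀ n : ℕ, n < M → ∀ Z : Fin (q + 1) → C(FNLS.Circ, ℂ),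
        FNLS.IsStages s N k b (uN ((n : ℝ) * k)) Z →
        FNLS.hNorm s (uN (((n : ℝ) + 1) * k) - Z (Fin.last q)) ≤ CΘ * k ^ (α + 1)) →
      (∃! P : (Fin (M + 1) → C(FNLS.Circ, ℂ)) × (Fin M → Fin (q + 1) → C(FNLS.Circ, ℂ)),
        FNLS.IsFullyDiscrete s N M k b u₀ P.1 P.2) ∧
      ∀ (U : Fin (M + 1) → C(FNLS.Circ, ℂ)) (Y : Fin M → Fin (q + 1) → C(FNLS.Circ, ℂ)),
        FNLS.IsFullyDiscrete s N M k b u₀ U Y →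
        ∀ n : Fin (M + 1), FNLS.hNorm s (U n - u (((n : ℕ) : ℝ) * k))
          ≤ C * (k ^ α + (N : ℝ) ^ (s - μ)) := by
  obtain ⟨B, huB⟩ := huμ
  have hB0 : 0 ≤ B := (FNLS.hNorm_nonneg _ _).trans (huB 0 ⟨le_rfl, hT.le⟩).2
  have hus : ∀ t ∈ Set.Icc (0 : ℝ) T, FNLS.MemH s (u t) ∧ FNLS.hNorm s (u t) ≤ B := fun t ht =>
    ⟨((huB t ht).1.mono hμ.le).1, ((huB t ht).1.mono hμ.le).2.trans (huB t ht).2⟩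
  obtain ⟨C₁, hC₁, hsemi⟩ := FNLS.exists_semidiscrete_const hs hs1 hT hμ hu huB
  obtain ⟨k₀, c, hk₀, hc, hstab⟩ :=
    FNLS.exists_one_step_const hs hs1 b (β := C₁ + B + 1) (by positivity)
  set A : ℝ := Real.exp (c * T) * (T * |CΘ|)
  have hA : 0 ≤ A := by positivity
  -- below `k₁` the step is short enough for stability, and the temporal error is at most one
  set k₁ : ℝ := min k₀ (min 1 (1 / (A + 1)))
  have hk₁ : 0 < k₁ := lt_min hk₀ (lt_min one_pos (by positivity))
  obtain ⟨D, hD, hlarge⟩ := FNLS.exists_large_step_bound hs1 u₀ (hb ⟨0, hq⟩) hk₁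
  refine ⟨C₁ + A + (D + B) / k₁ ^ α, fun N M k uN hN hk hMk huN hcond hΘ => ?_⟩
  have hsmall : ∀ j, N * |k * b j| * FNLS.hNorm 0 (FNLS.proj N u₀) ^ 2 ≤ 1 / 18 := fun j =>
    FNLS.small_of_cond hk (FNLS.l2Norm_sq _) (hcond j)
  refine ⟨FNLS.existsUnique_fullyDiscrete hs hs1 hN hsmall, fun U Y hUY n => ?_⟩
  have hN1 : (1 : ℝ) ≤ N := by exact_mod_cast hN
  have hP0 : 0 < (N : ℝ) ^ (s - μ) := Real.rpow_pos_of_pos (by linarith) _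
  have hP1 : (N : ℝ) ^ (s - μ) ≤ 1 := Real.rpow_le_one_of_one_le_of_nonpos hN1 (by linarith)
  have hkα : 0 < k ^ α := by positivity
  have ht : (((n : ℕ) : ℝ) * k) ∈ Set.Icc (0 : ℝ) T := by
    refine ⟨by positivity, ?_⟩
    rw [← hMk]
    have : ((n : ℕ) : ℝ) ≤ M := by exact_mod_cast Nat.lt_succ_iff.mp n.2
    gcongr
  have hUm := FNLS.memH_of_mem s (hUY.mem n)
  have hDB : 0 ≤ (D + B) / k₁ ^ α := by positivity
  rcases le_total k k₁ with hkk | hkk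
  · have hkk₀ : k ≤ k₀ := hkk.trans (min_le_left _ _)
    have hk1 : k ≤ 1 := hkk.trans ((min_le_right _ _).trans (min_le_left _ _))
    have hkA : k ≤ 1 / (A + 1) := hkk.trans ((min_le_right _ _).trans (min_le_right _ _))
    have hMε : Real.exp (c * T) * (M * (|CΘ| * k ^ (α + 1))) = A * k ^ α := by
      simp only [A]; rw [← hMk]; ring
    have hAk : A * k ^ α ≤ 1 := by
      rw [le_div_iff₀ (by positivity)] at hkA
      have h1 : k ^ α ≤ k := pow_le_of_le_one hk.le hk1 (by omega)
      have h2 := mul_le_mul_of_nonneg_left h1 hA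
      linarith
    have htemp := FNLS.temporal_error_le hs hs1 hT hN hk hMk huN hsmall hc (β := C₁ + B + 1)
      (fun t ht => by
        have h1 := (FNLS.memH_of_mem s (huN.mem t ht)).sub (hus t ht).1
        have h2 := (h1.1.add (hus t ht).1).2
        rw [sub_add_cancel] at h2
        have h3 := hsemi N uN hN huN t ht
        have h4 := mul_le_mul_of_nonneg_left hP1 hC₁
        linarith [(hus t ht).2])
      (fun v v' Y Y' => hstab N k hN hk hkk₀ v v' Y Y')
      (ε := |CΘ| * k ^ (α + 1)) (by positivity) (by rw [hMε]; exact hAk)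
      (fun n hn Z hZ => (hΘ n hn Z hZ).trans (by gcongr; exact le_abs_self _)) hUY n
    rw [hMε] at htemp
    have hmN := FNLS.memH_of_mem s (huN.mem _ ht)
    have htri := ((hUm.sub hmN).1.add (hmN.sub (hus _ ht).1).1).2
    rw [sub_add_sub_cancel] at htri
    have hspace := hsemi N uN hN huN _ ht
    have := mul_nonneg hA hP0.le
    have := mul_nonneg hC₁ hkα.le
    have := mul_nonneg hDB (add_nonneg hkα.le hP0.le)
    nlinarith
  · -- long steps: both solutions are bounded, and `k ^ α` is bounded from below
    have h1 := hlarge N k (U n) hkk (hsmall _) (hUY.mem n) (hUY.hNorm_zero_eq n)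
    have h2 := (hUm.sub (hus _ ht).1).2
    have h3 : D + B ≤ (D + B) / k₁ ^ α * k ^ α := by
      rw [div_mul_eq_mul_div, le_div_iff₀ (by positivity)]
      gcongr
    have := mul_nonneg (add_nonneg hC₁ hA) (add_nonneg hkα.le hP0.le)
    have := mul_nonneg hDB hP0.le
    have := (hus _ ht).2
    nlinarith
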